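/- Let $\Bbbk$ be a field. For a finite simple graph $G$ with vertex set $\{x_1,\dots,x_N\}$, let $I(G)=(x_ix_j : x_ix_j\in E(G))\subseteq S=\Bbbk[x_1,\dots,x_N]$ be its edge ideal and $G^c$ its complement. For a monomial ideal $I\subseteq S$ and $k\ge 0$, the homological shift ideal $\mathrm{HS}_k(I)$ is the ideal generated by the monomials $\mathbf x^{\mathbf a_{kj}}$, $j=1,\dots,b_k$, where $F_k=\bigoplus_{j=1}^{b_k}S(-\mathbf a_{kj})$ is the $k$-th module of the multigraded minimal free resolution $\cdots\to F_1\to F_0\to I\to 0$; write $\mathrm{HS}_k(G)=\mathrm{HS}_k(I(G))$. A monomial ideal $I$ has linear quotients if its minimal monomial generators can be ordered as $m_1,\dots,m_q$ so that for each $1\le i\le q-1$ the colon ideal $(m_1,\dots,m_i):m_{i+1}$ is generated by variables. Let $n\ge 6$ and $r\ge 0$ be integers and write $[m]=\{1,\dots,m\}$. Let $H_n$ be the graph with vertices $x_{r+1},\dots,x_{r+n}$ and edge set $$\begin{aligned}E(H_n)={}&\{x_{r+i}x_{r+i+1}: i\in[n-5]\}\cup\{x_{r+n-4}x_{r+n-2},\,x_{r+n-2}x_{r+n-3}\}\\&\cup\{x_{r+n-1}x_{r+j}: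 j\in[n]\setminus\{1,n-1\}\}\cup\{x_{r+n}x_{r+j}: j\in[n]\setminus\{n-3,n\}\}.\end{aligned}$$ Let $\mathrm{ACH}_{n,r}$ be the graph with vertices $x_1,\dots,x_{r+n}$ and edge set $$E(\mathrm{ACH}_{n,r})=E(H_n)\cup\{x_ix_j: i,j\in[r],\ i\ne j\}\cup\{x_ix_{r+j}: i\in[r],\ j\in\{n-2,n-1,n\}\}.$$ (Thus $\mathrm{ACH}_{n,r}^c$ is $H_n^c$ with $r$ new vertices, each adjacent exactly to $x_{r+1},\dots,x_{r+n-3}$.) Then, for every integer $k$: (i) if $2\le k<n-4$, then $\mathrm{HS}_k(\mathrm{ACH}_{n,r}^c)\neq 0$ and it has linear quotients; (ii) if $n-4\le k\le n+r-4$, then $\mathrm{HS}_k(\mathrm{ACH}_{n,r}^c)\neq 0$ and it does not have linear quotients; (iii) if $k>n+r-4$, then $\mathrm{HS}_k(\mathrm{ACH}_{n,r}^c)=0$. -/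

import Mathlib

open MvPolynomial

/-- The edge relation (on labels, listed in one direction) of the graph `H_n`, whose vertices
are labelled `r + 1, …, r + n`; for `r = 0` this is `H_n` on `1, …, n`. -/
def HRel (n r a b : ℕ) : Prop :=
  (∃ i, 1 ≤ i ∧ i ≤ n - 5 ∧ a = r + i ∧ b = r + i + 1) ∨
  (a = r + n - 4 ∧ b = r + n - 2) ∨
  (a = r + n - 2 ∧ b = r + n - 3) ∨
  (a = r + n - 1 ∧ ∃ j, 1 ≤ j ∧ j ≤ n ∧ j ≠ 1 ∧ j ≠ n - 1 ∧ b = r + j) ∨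
  (a = r + n ∧ ∃ j, 1 ≤ j ∧ j ≤ n ∧ j ≠ n - 3 ∧ j ≠ n ∧ b = r + j)

/-- The edge relation (on labels, listed in one direction) of `ACH_{n,r}`, whose vertices are
labelled `1, …, r + n`: the edges of `H_n` on `r + 1, …, r + n`, all edges inside `{1, …, r}`, and
all edges between `{1, …, r}` and `{r + n - 2, r + n - 1, r + n}`. -/
def ACHRel (n r a b : ℕ) : Prop :=
  HRel n r a b ∨
  (1 ≤ a ∧ a ≤ r ∧ 1 ≤ b ∧ b ≤ r ∧ a ≠ b) ∨
  (1 ≤ a ∧ a ≤ r ∧ (b = r + n - 2 ∨ b = r + n - 1 ∨ b = r + n))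

/-- The graph `ACH_{n,r}`; the element `v : Fin (r + n)` is the vertex with label `v + 1`. -/
def ACH (n r : ℕ) : SimpleGraph (Fin (r + n)) :=
  SimpleGraph.fromRel fun u v => ACHRel n r ((u : ℕ) + 1) ((v : ℕ) + 1)

/-- The edge ideal of a graph: generated by `x_u x_v` for the edges `uv`. -/
noncomputable def edgeIdeal (K : Type*) [Field K] {V : Type*} (G : SimpleGraph V) : Ideal (MvPolynomial V K) :=
  Ideal.span {p | ∃ u v, G.Adj u v ∧ p = X u * X v}

/-- A multigraded minimal free resolution `⋯ → F₁ → F₀ → I → 0` by free modules of finite rank,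
`F_i = ⨁_{j ∈ index i} S(-shift i j)`, where `S = K[x_v : v ∈ σ]`. -/
structure MinimalFreeResolution {σ K : Type*} [Field K] (I : Ideal (MvPolynomial σ K)) where
  /-- the index set of the basis of `F_i` -/
  index : ℕ → Type
  /-- `F_i` has finite rank -/
  finite_index : ∀ i, Finite (index i)
  /-- the multidegrees of the basis elements of `F_i` -/
  shift : ∀ i, index i → (σ →₀ ℕ)
  /-- the differential `F_{i+1} → F_i` -/
  d : ∀ i, (index (i + 1) →₀ MvPolynomial σ K) →ₗ[MvPolynomial σ K] (index i →₀ MvPolynomial σ K)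
  /-- the augmentation `F_0 → I ⊆ S` -/
  aug : (index 0 →₀ MvPolynomial σ K) →ₗ[MvPolynomial σ K] MvPolynomial σ K
  /-- The differentials preserve multidegrees: the entry in row `l`, column `j` is a scalar
  times `x ^ (shift (i+1) j - shift i l)` (and zero if that is not a monomial of `S`). -/
  d_homogeneous : ∀ i (j : index (i + 1)) (l : index i), ∃ c : K,
    monomial (shift i l) 1 * d i (Finsupp.single j 1) l = monomial (shift (i + 1) j) c
  /-- The augmentation preserves multidegrees. -/
  aug_homogeneous : ∀ l : index 0, ∃ c : K, aug (Finsupp.single l 1) = monomial (shift 0 l) c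
  /-- exactness at `F_{i+1}` -/
  exact : ∀ i, Function.Exact (d (i + 1)) (d i)
  /-- exactness at `F_0` -/
  exact_zero : Function.Exact (d 0) aug
  /-- exactness at `I` -/
  range_aug : LinearMap.range aug = I
  /-- minimality: `∂ F_{i+1} ⊆ 𝔪 F_i` with `𝔪` the ideal generated by the variables -/
  minimal : ∀ i, LinearMap.range (d i) ≤
    Ideal.span (Set.range (X : σ → MvPolynomial σ K)) •
      (⊤ : Submodule (MvPolynomial σ K) (index i →₀ MvPolynomial σ K))

/-- The `k`-th homological shift ideal: generated by the monomials `x ^ a` for which `S(-a)` is a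
summand of the `k`-th module of a multigraded minimal free resolution of `I`. (Such a resolution
is unique up to isomorphism, so all of them contribute the same monomials.) -/
noncomputable def HS {σ K : Type*} [Field K] (k : ℕ) (I : Ideal (MvPolynomial σ K)) :
    Ideal (MvPolynomial σ K) :=
  Ideal.span {p | ∃ (F : MinimalFreeResolution I) (j : F.index k),
    p = monomial (F.shift k j) 1}

/-- The exponents of the minimal monomial generators of a monomial ideal: the monomials of `I`
that are minimal for divisibility. -/
def mingens {σ K : Type*} [Field K] (I : Ideal (MvPolynomial σ K)) : Set (σ →₀ ℕ) :=
  {a | Minimal (fun b => monomial b (1 : K) ∈ I) a}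

/-- A monomial ideal has linear quotients if its minimal monomial generators can be listed without
repetition as `m_0, …, m_{q-1}` such that each colon ideal `(m_0, …, m_{i-1}) : m_i` is generated
by a set of variables. (For `i = 0` this is the zero ideal, generated by the empty set.) -/
def HasLinearQuotients {σ K : Type*} [Field K] (I : Ideal (MvPolynomial σ K)) : Prop :=
  ∃ (q : ℕ) (m : Fin q → (σ →₀ ℕ)), Function.Injective m ∧ Set.range m = mingens I ∧
    ∀ i : Fin q, ∃ T : Set σ,
      (Ideal.span {p | ∃ j < i, p = monomial (m j) (1 : K)}).colon {monomial (m i) (1 : K)} =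
        Ideal.span (X '' T)

/-! In `ACH n r` the larger neighbours of every vertex form a clique (`ACH_adj_of_adj_of_adj`), so
the graph is chordal and the natural order is a perfect elimination order. Hence the edge ideal of
the complement has linear quotients in lexicographic order, and iterated mapping cones give a
resolution whose basis elements in homological degree `k` have squarefree multidegrees of size `k +
2`. Sizes in different homological degrees differ, so the resolution is minimal, and
`HS_edgeIdeal_compl` reads off that `HS_k` is generated by the monomials of the sets `W` with `k +
2` elements that induce a disconnected subgraph (`SimpleGraph.Splits`). The rest is combinatorics of
such sets.

In values of `Fin (r + n)`, put `p = r`, `q = r + 1`, `e = r + n - 4`, `d = r + n - 3`, `b = r + n -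
2`, `a = r + n - 1`. The graph consists of a path `p, q, …, r + n - 5, d, e`, two adjacent vertices
`b` and `a` joined to the whole path except that `b` misses `p` and `a` misses `e`, and a clique on
the values below `r`, joined completely to `d`, `b`, `a`.

Small sets (`k + 2 ≤ n - 3`) satisfy a lexicographic exchange property (`ACH_exchange`), which
yields linear quotients. For `n - 4 ≤ k ≤ n + r - 4`, let `V` be the set of the last `k + 4`
vertices: the only disconnected sets of size `k + 2` inside `V` are `V \ {d, b}` and `V \ {q, a}`.
They differ in two elements with nothing between them, which obstructs linear quotients
(`not_hasLinearQuotients_of_pair`). Finally, every disconnected set omits at least two vertices, so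
nothing is left when `k > n + r - 4`. -/

theorem exists_seq_of_step {α : ℕ → Type*} (Q : ∀ k, α k → Prop)
    (R : ∀ k, α k → α (k + 1) → Prop) (x₀ : α 0) (h₀ : Q 0 x₀)
    (step : ∀ k x, Q k x → ∃ y, Q (k + 1) y ∧ R k x y) :
    ∃ f : ∀ k, α k, f 0 = x₀ ∧ (∀ k, Q k (f k)) ∧ ∀ k, R k (f k) (f (k + 1)) := by
  classical
  choose g hg using step
  let f : ∀ k, {x : α k // Q k x} := fun k =>
    Nat.rec ⟨x₀, h₀⟩ (fun k x => ⟨g k x.1 x.2, (hg k x.1 x.2).1⟩) k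
  exact ⟨fun k => (f k).1, rfl, fun k => (f k).2, fun k => (hg k (f k).1 (f k).2).2⟩

/-! ### Resolutions with scalar matrices: comparison maps, homotopies, uniqueness of minimal shifts
-/

section Filtered

variable {σ K : Type*} [Field K]

/-- The span of the basis vectors of multidegree at most `a`. -/
abbrev degLE (K : Type*) [Field K] {σ ι : Type*} (sh : ι → (σ →₀ ℕ)) (a : σ →₀ ℕ) :
    Submodule K (ι →₀ K) :=
  Finsupp.supported K K {l | sh l ≤ a}

theorem mem_degLE {ι : Type*} {sh : ι → (σ →₀ ℕ)} {a : σ →₀ ℕ} {x : ι →₀ K} :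
    x ∈ degLE K sh a ↔ ∀ l, x l ≠ 0 → sh l ≤ a := by
  rw [Finsupp.mem_supported]
  simp [Set.subset_def]

theorem single_mem_degLE {ι : Type*} (sh : ι → (σ →₀ ℕ)) (l : ι) (c : K) :
    Finsupp.single l c ∈ degLE K sh (sh l) := by
  classical
  rw [mem_degLE]
  intro l' hl'
  rw [Finsupp.single_apply] at hl'
  split_ifs at hl' with h
  · rw [h]
  · exact absurd rfl hl'

theorem degLE_mono {ι : Type*} (sh : ι → (σ →₀ ℕ)) {a b : σ →₀ ℕ} (h : a ≤ b) :
    degLE K sh a ≤ degLE K sh b := fun _ hx =>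
  mem_degLE.2 fun l hl => (mem_degLE.1 hx l hl).trans h

/-- A linear map that raises multidegrees by at most `m`. -/
def IsFiltered {ι κ : Type*} (s : ι → (σ →₀ ℕ)) (t : κ → (σ →₀ ℕ)) (m : σ →₀ ℕ)
    (φ : (ι →₀ K) →ₗ[K] (κ →₀ K)) : Prop :=
  ∀ j, φ (Finsupp.single j 1) ∈ degLE K t (s j + m)

theorem IsFiltered.map_mem {ι κ : Type*} {s : ι → (σ →₀ ℕ)} {t : κ → (σ →₀ ℕ)} {m : σ →₀ ℕ}
    {φ : (ι →₀ K) →ₗ[K] (κ →₀ K)} (h : IsFiltered s t m φ) {a : σ →₀ ℕ} {x : ι →₀ K}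
    (hx : x ∈ degLE K s a) : φ x ∈ degLE K t (a + m) := by
  classical
  have hsum : x = x.sum fun j c => c • Finsupp.single j (1 : K) := by simp
  rw [hsum, Finsupp.sum, map_sum]
  refine Submodule.sum_mem _ fun j hj => ?_
  rw [map_smul]
  refine Submodule.smul_mem _ _ (degLE_mono t ?_ (h j))
  exact add_le_add_left (mem_degLE.1 hx j (Finsupp.mem_support_iff.1 hj)) m

theorem exists_filtered_lift {ι κ : Type*} (s : ι → (σ →₀ ℕ)) (t : κ → (σ →₀ ℕ)) (m : σ →₀ ℕ)
    {W : Type*} [AddCommGroup W] [Module K W] (A : (ι →₀ K) →ₗ[K] W) (B : (κ →₀ K) →ₗ[K] W)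
    (h : ∀ j, ∃ y ∈ degLE K t (s j + m), B y = A (Finsupp.single j 1)) :
    ∃ φ : (ι →₀ K) →ₗ[K] (κ →₀ K), IsFiltered s t m φ ∧ ∀ x, B (φ x) = A x := by
  choose y hy hB using h
  refine ⟨Finsupp.linearCombination K y, fun j => by simpa using hy j, fun x => ?_⟩
  have : B ∘ₗ Finsupp.linearCombination K y = A := by
    ext j
    simp [hB]
  rw [← this]
  rfl

/-- A filtered model of a multigraded free resolution of `S / J`, where `J` is the monomial ideal
whose monomials have exponents in `U`: the strand in multidegree `a` is the complex of the
subspaces `degLE K (sh k) a`. -/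
structure FilteredResolution (K : Type*) [Field K] {σ : Type*} (U : Set (σ →₀ ℕ)) where
  idx : ℕ → Type
  finite_idx : ∀ k, Finite (idx k)
  sh : ∀ k, idx k → (σ →₀ ℕ)
  D : ∀ k, (idx (k + 1) →₀ K) →ₗ[K] (idx k →₀ K)
  filtered : ∀ k, IsFiltered (sh (k + 1)) (sh k) 0 (D k)
  D_D : ∀ k x, D k (D (k + 1) x) = 0
  exact : ∀ k a, ∀ x ∈ degLE K (sh (k + 1)) a, D k x = 0 →
    ∃ y ∈ degLE K (sh (k + 2)) a, D (k + 1) y = x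
  zero : idx 0
  eq_zero : ∀ l : idx 0, l = zero
  sh_zero : sh 0 zero = 0
  mem_iff : ∀ a, a ∈ U ↔ ∃ y ∈ degLE K (sh 1) a, D 0 y = Finsupp.single zero 1

namespace FilteredResolution

variable {U U' : Set (σ →₀ ℕ)}

theorem D_mem (F : FilteredResolution K U) {k : ℕ} {a : σ →₀ ℕ} {x : F.idx (k + 1) →₀ K}
    (hx : x ∈ degLE K (F.sh (k + 1)) a) : F.D k x ∈ degLE K (F.sh k) a := by
  simpa using (F.filtered k).map_mem hx

theorem eq_single (F : FilteredResolution K U) (x : F.idx 0 →₀ K) :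
    x = Finsupp.single F.zero (x F.zero) := by
  ext l
  rw [F.eq_zero l]
  simp

theorem exists_D_zero_eq (F : FilteredResolution K U) {a : σ →₀ ℕ} (c : K)
    (h : c ≠ 0 → a ∈ U) : ∃ y ∈ degLE K (F.sh 1) a, F.D 0 y = Finsupp.single F.zero c := by
  by_cases hc : c = 0
  · exact ⟨0, Submodule.zero_mem _, by simp [hc]⟩
  · obtain ⟨y, hy, hD⟩ := (F.mem_iff a).1 (h hc)
    exact ⟨c • y, Submodule.smul_mem _ _ hy, by simp [hD]⟩

theorem mem_of_D_zero_ne (F : FilteredResolution K U) {a : σ →₀ ℕ} {x : F.idx 1 →₀ K}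
    (hx : x ∈ degLE K (F.sh 1) a) (h : F.D 0 x F.zero ≠ 0) : a ∈ U := by
  refine (F.mem_iff a).2 ⟨(F.D 0 x F.zero)⁻¹ • x, Submodule.smul_mem _ _ hx, ?_⟩
  rw [map_smul, F.eq_single (F.D 0 x)]
  simp [h]

/-- The usual lifting along a free resolution, basis vector by basis vector. The case `m = 0`
compares two resolutions of the same quotient; for a generator `m` and a colon ideal `U'` it lifts
multiplication by `x ^ m`. -/
theorem exists_comparison (C : FilteredResolution K U') (F : FilteredResolution K U)
    (m : σ →₀ ℕ) (h : ∀ a ∈ U', a + m ∈ U) :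
    ∃ φ : ∀ k, (C.idx k →₀ K) →ₗ[K] (F.idx k →₀ K),
      (∀ c, φ 0 (Finsupp.single C.zero c) = Finsupp.single F.zero c) ∧
      (∀ k, IsFiltered (C.sh k) (F.sh k) m (φ k)) ∧
      ∀ k x, F.D k (φ (k + 1) x) = φ k (C.D k x) := by
  let φ₀ : (C.idx 0 →₀ K) →ₗ[K] (F.idx 0 →₀ K) :=
    Finsupp.linearCombination K fun _ => Finsupp.single F.zero (1 : K)
  have hφ₀ : ∀ c, φ₀ (Finsupp.single C.zero c) = Finsupp.single F.zero c := by
    intro c; simp [φ₀]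
  have hφ₀f : IsFiltered (C.sh 0) (F.sh 0) m φ₀ := by
    intro j
    rw [C.eq_zero j, hφ₀]
    refine degLE_mono _ ?_ (single_mem_degLE (F.sh 0) F.zero 1)
    rw [F.sh_zero]
    exact zero_le
  obtain ⟨φ₁, hφ₁f, hφ₁⟩ := exists_filtered_lift (C.sh 1) (F.sh 1) m (φ₀ ∘ₗ C.D 0) (F.D 0) (by
    intro j
    have := F.exists_D_zero_eq (a := C.sh 1 j + m) (C.D 0 (Finsupp.single j 1) C.zero)
      (fun hc => h _ (C.mem_of_D_zero_ne (single_mem_degLE (C.sh 1) j 1) hc))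
    obtain ⟨y, hy, hD⟩ := this
    refine ⟨y, hy, ?_⟩
    rw [LinearMap.comp_apply, C.eq_single (C.D 0 (Finsupp.single j 1)), hφ₀, hD])
  -- The recursion carries two consecutive components, because the next one is obtained from the
  -- commutation of these two with the differential.
  obtain ⟨f, hf0, hQ, hR⟩ := exists_seq_of_step
    (α := fun k => ((C.idx k →₀ K) →ₗ[K] (F.idx k →₀ K)) ×
      ((C.idx (k + 1) →₀ K) →ₗ[K] (F.idx (k + 1) →₀ K)))
    (fun k p => IsFiltered (C.sh k) (F.sh k) m p.1 ∧
      IsFiltered (C.sh (k + 1)) (F.sh (k + 1)) m p.2 ∧ ∀ x, F.D k (p.2 x) = p.1 (C.D k x))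
    (fun k p q => q.1 = p.2) (φ₀, φ₁) ⟨hφ₀f, hφ₁f, hφ₁⟩ (by
      rintro k ⟨p, q⟩ ⟨-, hq, hpq⟩
      obtain ⟨ψ, hψf, hψ⟩ := exists_filtered_lift (C.sh (k + 2)) (F.sh (k + 2)) m
        (q ∘ₗ C.D (k + 1)) (F.D (k + 1)) (by
          intro j
          refine F.exact k _ _ (hq.map_mem (C.D_mem (single_mem_degLE _ j 1))) ?_
          exact (hpq _).trans (by rw [C.D_D, map_zero]))
      exact ⟨(q, ψ), ⟨hq, hψf, hψ⟩, rfl⟩)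
  refine ⟨fun k => (f k).1, ?_, fun k => (hQ k).1, fun k x => ?_⟩
  · intro c
    simp only [hf0]
    exact hφ₀ c
  · simp only [hR k]
    exact (hQ k).2.2 x

/-- A filtered chain endomorphism that vanishes in degree `0` lifts the zero map of the resolved
quotient, hence is null-homotopic by a filtered homotopy. -/
theorem exists_homotopy (F : FilteredResolution K U)
    (ψ : ∀ k, (F.idx k →₀ K) →ₗ[K] (F.idx k →₀ K)) (h₀ : ψ 0 = 0)
    (hf : ∀ k, IsFiltered (F.sh k) (F.sh k) 0 (ψ k))
    (hD : ∀ k x, F.D k (ψ (k + 1) x) = ψ k (F.D k x)) :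
    ∃ s : ∀ k, (F.idx k →₀ K) →ₗ[K] (F.idx (k + 1) →₀ K), s 0 = 0 ∧
      (∀ k, IsFiltered (F.sh k) (F.sh (k + 1)) 0 (s k)) ∧
      ∀ k x, ψ (k + 1) x = F.D (k + 1) (s (k + 1) x) + s k (F.D k x) := by
  obtain ⟨s, hs0, hQ, hR⟩ := exists_seq_of_step
    (α := fun k => ((F.idx k →₀ K) →ₗ[K] (F.idx (k + 1) →₀ K)))
    -- The invariant `D s D = ψ D` says exactly that `ψ - s D` takes values in cycles one degree
    -- higher, so that it lifts.
    (fun k s => IsFiltered (F.sh k) (F.sh (k + 1)) 0 s ∧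
      ∀ x, F.D k (s (F.D k x)) = ψ k (F.D k x))
    (fun k s s' => ∀ x, ψ (k + 1) x = F.D (k + 1) (s' x) + s (F.D k x)) 0
    ⟨fun j => by simp, by simp [h₀]⟩ (by
      rintro k s ⟨hs, hsD⟩
      obtain ⟨s', hs'f, hs'⟩ := exists_filtered_lift (F.sh (k + 1)) (F.sh (k + 2)) 0
        (ψ (k + 1) - s ∘ₗ F.D k) (F.D (k + 1)) (by
          intro j
          refine F.exact k _ _ (Submodule.sub_mem _ (hf (k + 1) j) ?_) ?_
          · exact hs.map_mem (F.D_mem (single_mem_degLE _ j 1))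
          · rw [LinearMap.sub_apply, map_sub, hD, LinearMap.comp_apply, hsD, sub_self])
      refine ⟨s', ⟨hs'f, fun x => ?_⟩, fun x => ?_⟩
      · rw [hs', LinearMap.sub_apply, LinearMap.comp_apply, F.D_D, map_zero, sub_zero]
      · rw [hs', LinearMap.sub_apply, LinearMap.comp_apply, sub_add_cancel])
  exact ⟨s, hs0, fun k => (hQ k).1, hR⟩

/-- A nonzero matrix entry of a composite passes through some basis vector, whose shift is
sandwiched between those of source and target. On the diagonal all three shifts therefore agree. -/
theorem exists_ne_zero_of_comp_apply_ne_zero {ι κ τ : Type*} {s : ι → (σ →₀ ℕ)} {t : κ → (σ →₀ ℕ)}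
    {u : τ → (σ →₀ ℕ)} {φ : (ι →₀ K) →ₗ[K] (κ →₀ K)} {ψ : (κ →₀ K) →ₗ[K] (τ →₀ K)}
    (hφ : IsFiltered s t 0 φ) (hψ : IsFiltered t u 0 ψ) {j : ι} {i : τ}
    (h : ψ (φ (Finsupp.single j 1)) i ≠ 0) :
    ∃ l, φ (Finsupp.single j 1) l ≠ 0 ∧ ψ (Finsupp.single l 1) i ≠ 0 ∧ u i ≤ t l ∧ t l ≤ s j := by
  have hsum : φ (Finsupp.single j 1) =
      (φ (Finsupp.single j 1)).sum fun l c => c • Finsupp.single l (1 : K) := by simp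
  rw [hsum, Finsupp.sum, map_sum, Finsupp.finsetSum_apply] at h
  obtain ⟨l, hl, hne⟩ := Finset.exists_ne_zero_of_sum_ne_zero h
  rw [map_smul, Finsupp.smul_apply, smul_eq_mul] at hne
  have h1 := left_ne_zero_of_mul hne
  have h2 := right_ne_zero_of_mul hne
  refine ⟨l, h1, h2, ?_, ?_⟩
  · simpa using mem_degLE.1 (hψ l) i h2
  · simpa using mem_degLE.1 (hφ j) l h1

/-- The shifts of a minimal resolution occur in every resolution. -/
theorem exists_sh_eq (F G : FilteredResolution K U)
    (hmin : ∀ k j l, F.sh (k + 2) j = F.sh (k + 1) l → F.D (k + 1) (Finsupp.single j 1) l = 0)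
    (k : ℕ) (j : F.idx (k + 1)) : ∃ l : G.idx (k + 1), G.sh (k + 1) l = F.sh (k + 1) j := by
  obtain ⟨f, hf0, hff, hfD⟩ := F.exists_comparison G 0 (by simp)
  obtain ⟨g, hg0, hgf, hgD⟩ := G.exists_comparison F 0 (by simp)
  obtain ⟨s, hs0, hsf, hs⟩ := F.exists_homotopy (fun k => g k ∘ₗ f k - LinearMap.id)
    (by
      ext1 l
      rw [F.eq_zero l]
      ext1
      simp [hf0, hg0])
    (by
      intro k j
      refine Submodule.sub_mem _ ?_ ?_
      · exact (hgf k).map_mem (hff k j)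
      · simpa using single_mem_degLE (F.sh k) j (1 : K))
    (by
      intro k x
      simp [hfD, hgD])
  -- Diagonal entry at `j` of `g f - 1 = D s + s D`. Either summand could be nonzero only through a
  -- basis vector of the same shift in an adjacent degree, which minimality excludes. So the entry
  -- of `g f` is `1`, and it passes through a basis vector of `G` of the same shift.
  have key := DFunLike.congr_fun (hs k (Finsupp.single j 1)) j
  simp only [LinearMap.sub_apply, LinearMap.comp_apply, LinearMap.id_apply, Finsupp.sub_apply,
    Finsupp.add_apply, Finsupp.single_eq_same] at key
  have h1 : F.D (k + 1) (s (k + 1) (Finsupp.single j 1)) j = 0 := by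
    by_contra hne
    obtain ⟨l, -, h2, h3, h4⟩ := exists_ne_zero_of_comp_apply_ne_zero (hsf (k + 1)) (F.filtered (k + 1)) hne
    exact h2 (hmin k l j (le_antisymm h4 h3))
  have h2 : s k (F.D k (Finsupp.single j 1)) j = 0 := by
    by_contra hne
    obtain _ | k := k
    · simp [hs0] at hne
    · obtain ⟨l, h1, -, h3, h4⟩ := exists_ne_zero_of_comp_apply_ne_zero (F.filtered (k + 1)) (hsf (k + 1)) hne
      exact h1 (hmin k j l (le_antisymm h3 h4))
  have h3 : g (k + 1) (f (k + 1) (Finsupp.single j 1)) j ≠ 0 := by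
    rw [h1, h2, add_zero, sub_eq_zero] at key
    rw [key]
    exact one_ne_zero
  obtain ⟨l, -, -, h4, h5⟩ := exists_ne_zero_of_comp_apply_ne_zero (hff (k + 1)) (hgf (k + 1)) h3
  exact ⟨l, le_antisymm h5 h4⟩

end FilteredResolution

end Filtered

/-! ### Mapping cones and the resolution of ideals with linear quotients -/

section Cone

variable {σ K : Type*} [Field K]

/-- The shifted strand is zero in degrees `a` not above `m`, which accounts for the alternative `x =
0`. -/
theorem mem_degLE_add {ι : Type*} {t : ι → (σ →₀ ℕ)} {m a : σ →₀ ℕ} {x : ι →₀ K} :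
    x ∈ degLE K (fun l => t l + m) a ↔ x = 0 ∨ ∃ a', a = a' + m ∧ x ∈ degLE K t a' := by
  constructor
  · intro hx
    by_cases h0 : x = 0
    · exact Or.inl h0
    · obtain ⟨l, hl⟩ := Finsupp.ne_iff.1 h0
      have hm : m ≤ a := le_trans (self_le_add_left m (t l)) (mem_degLE.1 hx l hl)
      refine Or.inr ⟨a - m, (tsub_add_cancel_of_le hm).symm, mem_degLE.2 fun l hl => ?_⟩
      exact le_tsub_of_add_le_right (mem_degLE.1 hx l hl)
  · rintro (rfl | ⟨a', rfl, hx⟩)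
    · exact Submodule.zero_mem _
    · exact mem_degLE.2 fun l hl => add_le_add_left (mem_degLE.1 hx l hl) m

theorem mem_degLE_sum {ι κ : Type*} {s : ι → (σ →₀ ℕ)} {t : κ → (σ →₀ ℕ)} {a : σ →₀ ℕ}
    {x : ι ⊕ κ →₀ K} :
    x ∈ degLE K (Sum.elim s t) a ↔
      (Finsupp.sumFinsuppLEquivProdFinsupp K x).1 ∈ degLE K s a ∧
        (Finsupp.sumFinsuppLEquivProdFinsupp K x).2 ∈ degLE K t a := by
  simp [mem_degLE]

namespace FilteredResolution

variable {U U' : Set (σ →₀ ℕ)}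

/-- The index sets of the mapping cone of `C → F`. -/
def coneIdx (F : FilteredResolution K U) (C : FilteredResolution K U') : ℕ → Type
  | 0 => F.idx 0
  | k + 1 => F.idx (k + 1) ⊕ C.idx k

/-- The shifts of the mapping cone of a comparison map that raises multidegrees by `m`. -/
noncomputable def coneSh (F : FilteredResolution K U) (C : FilteredResolution K U') (m : σ →₀ ℕ) :
    ∀ k, coneIdx F C k → (σ →₀ ℕ)
  | 0 => F.sh 0
  | k + 1 => Sum.elim (F.sh (k + 1)) fun l => C.sh k l + m

/-- The positive part of the mapping cone is a direct sum. -/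
noncomputable def conePair (F : FilteredResolution K U) (C : FilteredResolution K U') (k : ℕ) :
    ((F.idx (k + 1) →₀ K) × (C.idx k →₀ K)) ≃ₗ[K] (coneIdx F C (k + 1) →₀ K) :=
  (Finsupp.sumFinsuppLEquivProdFinsupp K).symm

/-- The differential of the mapping cone. -/
noncomputable def coneD (F : FilteredResolution K U) (C : FilteredResolution K U')
    (φ : ∀ k, (C.idx k →₀ K) →ₗ[K] (F.idx k →₀ K)) :
    ∀ k, (coneIdx F C (k + 1) →₀ K) →ₗ[K] (coneIdx F C k →₀ K)
  | 0 => (F.D 0).coprod (φ 0) ∘ₗ (conePair F C 0).symm.toLinearMap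
  | k + 1 => (conePair F C k).toLinearMap ∘ₗ
      (((F.D (k + 1)).coprod (φ (k + 1))).prod (-(C.D k ∘ₗ LinearMap.snd K _ _))) ∘ₗ
      (conePair F C (k + 1)).symm.toLinearMap

theorem coneD_zero_apply (F : FilteredResolution K U) (C : FilteredResolution K U')
    (φ : ∀ k, (C.idx k →₀ K) →ₗ[K] (F.idx k →₀ K)) (x : F.idx 1 →₀ K) (y : C.idx 0 →₀ K) :
    coneD F C φ 0 (conePair F C 0 (x, y)) = (F.D 0 x + φ 0 y : F.idx 0 →₀ K) := by
  change (F.D 0).coprod (φ 0) ((conePair F C 0).symm (conePair F C 0 (x, y))) = _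
  rw [LinearEquiv.symm_apply_apply, LinearMap.coprod_apply]

theorem coneD_succ_apply (F : FilteredResolution K U) (C : FilteredResolution K U')
    (φ : ∀ k, (C.idx k →₀ K) →ₗ[K] (F.idx k →₀ K)) (k : ℕ)
    (x : F.idx (k + 2) →₀ K) (y : C.idx (k + 1) →₀ K) :
    coneD F C φ (k + 1) (conePair F C (k + 1) (x, y)) =
      conePair F C k (F.D (k + 1) x + φ (k + 1) y, -C.D k y) := by
  change conePair F C k
    ((((F.D (k + 1)).coprod (φ (k + 1))).prod (-(C.D k ∘ₗ LinearMap.snd K _ _)))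
      ((conePair F C (k + 1)).symm (conePair F C (k + 1) (x, y)))) = _
  rw [LinearEquiv.symm_apply_apply]
  rfl

theorem conePair_mem (F : FilteredResolution K U) (C : FilteredResolution K U')
    (m a : σ →₀ ℕ) (k : ℕ) {x : F.idx (k + 1) →₀ K} {y : C.idx k →₀ K} :
    conePair F C k (x, y) ∈ degLE K (coneSh F C m (k + 1)) a ↔
      x ∈ degLE K (F.sh (k + 1)) a ∧ y ∈ degLE K (fun l => C.sh k l + m) a := by
  change (Finsupp.sumFinsuppLEquivProdFinsupp K).symm (x, y) ∈
    degLE K (Sum.elim (F.sh (k + 1)) fun l => C.sh k l + m) a ↔ _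
  rw [mem_degLE_sum, LinearEquiv.apply_symm_apply]

theorem map_mem_of_shifted {C : FilteredResolution K U'} {F : FilteredResolution K U}
    {m a : σ →₀ ℕ} {k : ℕ} {φ : (C.idx k →₀ K) →ₗ[K] (F.idx k →₀ K)}
    (hφ : IsFiltered (C.sh k) (F.sh k) m φ) {y : C.idx k →₀ K}
    (hy : y ∈ degLE K (fun l => C.sh k l + m) a) : φ y ∈ degLE K (F.sh k) a := by
  rcases mem_degLE_add.1 hy with rfl | ⟨a', rfl, hy'⟩
  · rw [map_zero]
    exact Submodule.zero_mem _
  · exact hφ.map_mem hy'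

theorem D_mem_shifted (C : FilteredResolution K U') {m a : σ →₀ ℕ} {k : ℕ}
    {y : C.idx (k + 1) →₀ K} (hy : y ∈ degLE K (fun l => C.sh (k + 1) l + m) a) :
    C.D k y ∈ degLE K (fun l => C.sh k l + m) a := by
  rcases mem_degLE_add.1 hy with rfl | ⟨a', rfl, hy'⟩
  · rw [map_zero]
    exact Submodule.zero_mem _
  · exact mem_degLE_add.2 (Or.inr ⟨a', rfl, C.D_mem hy'⟩)

theorem forall_conePair (F : FilteredResolution K U) (C : FilteredResolution K U') (k : ℕ)
    {P : (coneIdx F C (k + 1) →₀ K) → Prop} (h : ∀ x y, P (conePair F C k (x, y))) (z) : P z := by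
  have := h ((conePair F C k).symm z).1 ((conePair F C k).symm z).2
  rwa [Prod.mk.eta, LinearEquiv.apply_symm_apply] at this

theorem isFiltered_of_map_mem {ι κ : Type*} {s : ι → (σ →₀ ℕ)} {t : κ → (σ →₀ ℕ)}
    {φ : (ι →₀ K) →ₗ[K] (κ →₀ K)} (h : ∀ a, ∀ x ∈ degLE K s a, φ x ∈ degLE K t a) :
    IsFiltered s t 0 φ := fun j => by
  simpa using h (s j) _ (single_mem_degLE s j 1)

/-- Multiplication by `x ^ m` gives the exact sequence `0 → S/(J : x ^ m)(-m) → S/J → S/(J + (x ^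
m)) → 0`. With `F` resolving the middle term and `C` the left one, the cone of a lift of this map
resolves the right one. -/
theorem exists_cone (F : FilteredResolution K U) (m : σ →₀ ℕ)
    (C : FilteredResolution K {a | a + m ∈ U}) :
    ∃ E : FilteredResolution K (U ∪ {a | m ≤ a}),
      Set.range (E.sh 0) = Set.range (F.sh 0) ∧
      ∀ k, Set.range (E.sh (k + 1)) =
        Set.range (F.sh (k + 1)) ∪ Set.range fun l => C.sh k l + m := by
  obtain ⟨φ, hφ0, hφf, hφD⟩ := C.exists_comparison F m (fun a ha => ha)
  refine ⟨{
    idx := coneIdx F C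
    finite_idx := fun k => ?_
    sh := coneSh F C m
    D := coneD F C φ
    filtered := fun k => ?_
    D_D := fun k => ?_
    exact := fun k a => ?_
    zero := F.zero
    eq_zero := F.eq_zero
    sh_zero := F.sh_zero
    mem_iff := fun a => ?_ }, rfl, fun k => ?_⟩
  · have := F.finite_idx
    have := C.finite_idx
    cases k with
    | zero => exact F.finite_idx 0
    | succ k => exact inferInstanceAs (Finite (F.idx (k + 1) ⊕ C.idx k))
  · refine isFiltered_of_map_mem fun a => ?_
    cases k with
    | zero =>
      refine forall_conePair F C _ fun x y h => ?_
      rw [conePair_mem] at h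
      rw [coneD_zero_apply]
      exact Submodule.add_mem _ (F.D_mem h.1) (map_mem_of_shifted (hφf 0) h.2)
    | succ k =>
      refine forall_conePair F C _ fun x y h => ?_
      rw [conePair_mem] at h
      rw [coneD_succ_apply, conePair_mem]
      exact ⟨Submodule.add_mem _ (F.D_mem h.1) (map_mem_of_shifted (hφf _) h.2),
        Submodule.neg_mem _ (C.D_mem_shifted h.2)⟩
  · refine forall_conePair F C _ fun x y => ?_
    rw [coneD_succ_apply]
    cases k with
    | zero =>
      rw [coneD_zero_apply, map_add, F.D_D, hφD, map_neg, zero_add,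
        add_neg_cancel]
      rfl
    | succ k =>
      rw [coneD_succ_apply, map_add, F.D_D, hφD, map_neg, map_neg, C.D_D, zero_add,
        add_neg_cancel, neg_zero, neg_zero]
      exact (conePair F C k).map_zero
  · refine forall_conePair F C _ fun x y h hD => ?_
    rw [conePair_mem] at h
    obtain ⟨hx, hy⟩ := h
    obtain ⟨y', hy', hyy, hxy⟩ : ∃ y' ∈ degLE K (fun l => C.sh (k + 1) l + m) a,
        C.D k y' = -y ∧ F.D k x + φ k y = 0 := by
      cases k with
      | zero =>
        rw [coneD_zero_apply] at hD
        rcases mem_degLE_add.1 hy with rfl | ⟨a', rfl, hy1⟩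
        · exact ⟨0, Submodule.zero_mem _, by simp, hD⟩
        -- At the bottom of `C` there is no exactness to use; injectivity of multiplication by `x ^
        -- m` replaces it. If `y` is nonzero, then `D x = -φ y` shows `a' + m ∈ U`, so `a'` lies in
        -- the colon ideal and `y` is a boundary.
        · obtain ⟨y', hy', hyy⟩ := C.exists_D_zero_eq (a := a') (-(y C.zero)) (fun hc => by
            refine F.mem_of_D_zero_ne hx ?_
            have hx0 : F.D 0 x = -Finsupp.single F.zero (y C.zero) := by
              rw [← hφ0, ← C.eq_single y]
              exact eq_neg_of_add_eq_zero_left hD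
            rw [hx0]
            simpa using hc)
          refine ⟨y', mem_degLE_add.2 (Or.inr ⟨a', rfl, hy'⟩), ?_, hD⟩
          rw [hyy, C.eq_single y]
          simp
      | succ k =>
        rw [coneD_succ_apply, LinearEquiv.map_eq_zero_iff, Prod.mk_eq_zero, neg_eq_zero] at hD
        rcases mem_degLE_add.1 hy with rfl | ⟨a', rfl, hy1⟩
        · exact ⟨0, Submodule.zero_mem _, by simp, hD.1⟩
        · obtain ⟨y', hy', hyy⟩ := C.exact k a' (-y) (Submodule.neg_mem _ hy1) (by simp [hD.2])
          exact ⟨y', mem_degLE_add.2 (Or.inr ⟨a', rfl, hy'⟩), hyy, hD.1⟩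
    obtain ⟨x', hx', hxx⟩ := F.exact k a (x - φ (k + 1) y')
      (Submodule.sub_mem _ hx (map_mem_of_shifted (hφf _) hy'))
      (by rw [map_sub, hφD, hyy, map_neg, sub_neg_eq_add, hxy])
    refine ⟨conePair F C (k + 1) (x', y'),
      (conePair_mem F C m a (k + 1)).2 ⟨hx', hy'⟩, ?_⟩
    rw [coneD_succ_apply, hxx, hyy, neg_neg, sub_add_cancel]
  · constructor
    · rintro (ha | ha)
      · obtain ⟨x, hx, hD⟩ := (F.mem_iff a).1 ha
        refine ⟨conePair F C 0 (x, 0),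
          (conePair_mem F C m a 0).2 ⟨hx, Submodule.zero_mem _⟩, ?_⟩
        rw [coneD_zero_apply, map_zero, add_zero, hD]
        rfl
      · refine ⟨conePair F C 0 (0, Finsupp.single C.zero 1),
          (conePair_mem F C m a 0).2 ⟨Submodule.zero_mem _, ?_⟩, ?_⟩
        · refine mem_degLE_add.2 (Or.inr ⟨a - m, (tsub_add_cancel_of_le ha).symm, ?_⟩)
          refine degLE_mono _ ?_ (single_mem_degLE (C.sh 0) C.zero 1)
          rw [C.sh_zero]
          exact zero_le
        · rw [coneD_zero_apply, map_zero, zero_add, hφ0]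
          rfl
    · rintro ⟨z, hz, hD⟩
      revert hz hD
      refine forall_conePair F C 0 (P := fun z => z ∈ degLE K (coneSh F C m 1) a →
        coneD F C φ 0 z = Finsupp.single F.zero 1 → a ∈ U ∪ {a | m ≤ a}) (fun x y hz hD => ?_) z
      rw [conePair_mem] at hz
      rw [coneD_zero_apply] at hD
      rcases mem_degLE_add.1 hz.2 with rfl | ⟨a', rfl, -⟩
      · rw [map_zero, add_zero] at hD
        exact Or.inl ((F.mem_iff a).2 ⟨x, hz.1, hD⟩)
      · exact Or.inr (self_le_add_left m a')
  · change Set.range (Sum.elim (F.sh (k + 1)) fun l => C.sh k l + m) = _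
    exact Set.Sum.elim_range _ _

end FilteredResolution

/-- There is a filtered resolution with the given sets of shifts. -/
def HasShifts (K : Type*) [Field K] {σ : Type*} (U : Set (σ →₀ ℕ)) (B : ℕ → Set (σ →₀ ℕ)) :
    Prop :=
  ∃ F : FilteredResolution K U, Set.range (F.sh 0) = {0} ∧ ∀ k, Set.range (F.sh (k + 1)) = B k

theorem hasShifts_empty : HasShifts K (∅ : Set (σ →₀ ℕ)) fun _ => ∅ := by
  let idx : ℕ → Type := fun k => Nat.rec Unit (fun _ _ => Empty) k
  have he : ∀ k, IsEmpty (idx (k + 1)) := fun k => inferInstanceAs (IsEmpty Empty)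
  refine ⟨{
    idx := idx
    finite_idx := fun k => ?_
    sh := fun _ _ => 0
    D := fun _ => 0
    filtered := fun k j => (he k).elim j
    D_D := fun k x => by simp
    exact := fun k a x _ _ => ⟨0, Submodule.zero_mem _, ?_⟩
    zero := ()
    eq_zero := fun _ => rfl
    sh_zero := rfl
    mem_iff := fun a => ?_ }, ?_, fun k => ?_⟩
  · cases k with
    | zero => exact inferInstanceAs (Finite Unit)
    | succ k => exact inferInstanceAs (Finite Empty)
  · ext j
    exact (he k).elim j
  · simp only [Set.mem_empty_iff_false, LinearMap.zero_apply, false_iff, not_exists, not_and]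
    intro _ _ h
    exact one_ne_zero (Finsupp.single_eq_zero.1 h.symm)
  · ext a
    simp only [Set.mem_range, Set.mem_singleton_iff]
    exact ⟨fun ⟨_, h⟩ => h.symm, fun h => ⟨(), h.symm⟩⟩
  · have := he k
    exact Set.range_eq_empty _

theorem HasShifts.cone {U : Set (σ →₀ ℕ)} {B C : ℕ → Set (σ →₀ ℕ)} (hF : HasShifts K U B)
    (m : σ →₀ ℕ) (hC : HasShifts K {a | a + m ∈ U} C) :
    HasShifts K (U ∪ {a | m ≤ a}) fun k =>
      B k ∪ match k with
        | 0 => {m}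
        | k + 1 => (fun c => c + m) '' C k := by
  obtain ⟨F, hF0, hF⟩ := hF
  obtain ⟨C, hC0, hC⟩ := hC
  obtain ⟨E, hE0, hE⟩ := F.exists_cone m C
  refine ⟨E, hE0.trans hF0, fun k => ?_⟩
  rw [hE, hF]
  congr 1
  have : (Set.range fun l => C.sh k l + m) = (fun c => c + m) '' Set.range (C.sh k) := by
    rw [← Set.range_comp]
    rfl
  rw [this]
  cases k with
  | zero => simp [hC0]
  | succ k => simp [hC]

/-- The exponent of the squarefree monomial with support `A`. -/
noncomputable def sqfree (A : Finset σ) : σ →₀ ℕ := Finsupp.indicator A fun _ _ => 1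

theorem sqfree_apply [DecidableEq σ] (A : Finset σ) (v : σ) :
    sqfree A v = if v ∈ A then 1 else 0 := by
  simp [sqfree, Finsupp.indicator_apply]

/-- The Koszul complex as an iterated cone: for `t ∉ T` the ideal generated by the variables in `T`
equals its own colon by `x_t`, so adjoining `t` adds a copy of the complex shifted by `x_t`. -/
theorem hasShifts_koszul [DecidableEq σ] (T : Finset σ) :
    HasShifts K {a : σ →₀ ℕ | ∃ t ∈ T, a t ≠ 0} fun k =>
      {b | ∃ A ⊆ T, A.card = k + 1 ∧ b = sqfree A} := by
  induction T using Finset.induction_on with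
  | empty =>
    convert hasShifts_empty (σ := σ) (K := K) using 1
    · simp
    · ext k b
      simp only [Finset.subset_empty, Set.mem_ofPred_eq, Set.mem_empty_iff_false, iff_false]
      rintro ⟨A, rfl, h, -⟩
      simp at h
  | insert t T ht ih =>
    have key := ih.cone (Finsupp.single t 1) (C := fun k =>
      {b | ∃ A ⊆ T, A.card = k + 1 ∧ b = sqfree A}) (by
        convert ih using 2
        ext a
        simp only [Set.mem_ofPred_eq]
        refine exists_congr fun u => and_congr_right fun hu => ?_
        have : t ≠ u := fun h => ht (h ▸ hu)
        simp [this])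
    have hins : ∀ A ⊆ T, sqfree (insert t A) = sqfree A + Finsupp.single t 1 := by
      intro A hA
      have htA : t ∉ A := fun h => ht (hA h)
      ext u
      rw [Finsupp.add_apply, sqfree_apply, sqfree_apply, Finsupp.single_apply]
      by_cases hu : t = u
      · subst hu
        simp [htA]
      · simp [hu, Ne.symm hu]
    convert key using 1
    · ext a
      simp only [Finset.mem_insert, Set.mem_ofPred_eq, Set.mem_union, Finsupp.single_le_iff,
        Nat.one_le_iff_ne_zero]
      aesop
    · ext k b
      have hsplit : b ∈ {b | ∃ A ⊆ insert t T, A.card = k + 1 ∧ b = sqfree A} ↔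
          (∃ A ⊆ T, A.card = k + 1 ∧ b = sqfree A) ∨
          ∃ A ⊆ T, A.card = k ∧ b = sqfree A + Finsupp.single t 1 := by
        constructor
        · rintro ⟨A, hA, hc, rfl⟩
          by_cases htA : t ∈ A
          · refine Or.inr ⟨A.erase t, ?_, ?_, ?_⟩
            · rw [← Finset.subset_insert_iff]
              exact hA
            · rw [Finset.card_erase_of_mem htA, hc]
              rfl
            · rw [← hins _ (by rw [← Finset.subset_insert_iff]; exact hA), Finset.insert_erase htA]
          · exact Or.inl ⟨A, (Finset.subset_insert_iff_of_notMem htA).1 hA, hc, rfl⟩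
        · rintro (⟨A, hA, hc, rfl⟩ | ⟨A, hA, hc, rfl⟩)
          · exact ⟨A, hA.trans (Finset.subset_insert _ _), hc, rfl⟩
          · refine ⟨insert t A, Finset.insert_subset_insert _ hA, ?_, (hins A hA).symm⟩
            rw [Finset.card_insert_of_notMem (fun h => ht (hA h)), hc]
      rw [hsplit]
      cases k with
      | zero =>
        simp only [Finset.card_eq_zero, Set.mem_union, Set.mem_ofPred_eq, Set.mem_singleton_iff]
        refine or_congr Iff.rfl ?_
        constructor
        · rintro ⟨A, -, rfl, rfl⟩
          ext u
          simp [sqfree_apply]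
        · rintro rfl
          refine ⟨∅, by simp, rfl, ?_⟩
          ext u
          simp [sqfree_apply]
      | succ k =>
        simp only [Set.mem_union, Set.mem_ofPred_eq, Set.mem_image]
        refine or_congr Iff.rfl ?_
        constructor
        · rintro ⟨A, hA, hc, rfl⟩
          exact ⟨_, ⟨A, hA, hc, rfl⟩, rfl⟩
        · rintro ⟨_, ⟨A, hA, hc, rfl⟩, rfl⟩
          exact ⟨A, hA, hc, rfl⟩

/-- The resolution of a monomial ideal with linear quotients. -/
theorem hasShifts_of_linearQuotients [DecidableEq σ] {α : Type*} [LinearOrder α]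
    (m : α → (σ →₀ ℕ)) (T : α → Finset σ) (E : Finset α)
    (h : ∀ g ∈ E, ∀ a, (∃ g' ∈ E, g' < g ∧ m g' ≤ a + m g) ↔ ∃ t ∈ T g, a t ≠ 0) :
    HasShifts K {a | ∃ g ∈ E, m g ≤ a} fun k =>
      {b | ∃ g ∈ E, ∃ A ⊆ T g, A.card = k ∧ b = sqfree A + m g} := by
  induction E using Finset.induction_on_max with
  | empty =>
    convert hasShifts_empty (σ := σ) (K := K) using 1
    · simp
    · ext k b
      simp
  | insert g E hg ih =>
    have hgE : g ∉ E := fun hm => lt_irrefl _ (hg g hm)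
    have hE := ih (fun g₁ hg₁ a => by
      rw [← h g₁ (Finset.mem_insert_of_mem hg₁) a]
      constructor
      · rintro ⟨g', hg', hlt⟩
        exact ⟨g', Finset.mem_insert_of_mem hg', hlt⟩
      · rintro ⟨g', hg', hlt, hle⟩
        rcases Finset.mem_insert.1 hg' with rfl | hg'
        · exact absurd (hg g₁ hg₁) hlt.not_gt
        · exact ⟨g', hg', hlt, hle⟩)
    -- Since `g` is the largest index, all of `E` precedes it, and by `h` the colon ideal is
    -- generated by the variables in `T g`; it is resolved by their Koszul complex.
    have key := hE.cone (m g) (C := fun k => {b | ∃ A ⊆ T g, A.card = k + 1 ∧ b = sqfree A}) (by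
      convert hasShifts_koszul (K := K) (T g) using 1
      ext a
      rw [Set.mem_ofPred_eq, Set.mem_ofPred_eq, Set.mem_ofPred_eq,
        ← h g (Finset.mem_insert_self _ _) a]
      constructor
      · rintro ⟨g', hg', hle⟩
        exact ⟨g', Finset.mem_insert_of_mem hg', hg _ hg', hle⟩
      · rintro ⟨g', hg', hlt, hle⟩
        rcases Finset.mem_insert.1 hg' with rfl | hg'
        · exact absurd hlt (lt_irrefl _)
        · exact ⟨g', hg', hle⟩)
    convert key using 1
    · ext a
      simp [or_comm]
    · ext k b
      simp only [Finset.exists_mem_insert, Set.mem_ofPred_eq, Set.mem_union]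
      rw [or_comm]
      refine or_congr Iff.rfl ?_
      cases k with
      | zero =>
        simp only [Finset.card_eq_zero, Set.mem_singleton_iff]
        constructor
        · rintro ⟨A, -, rfl, rfl⟩
          ext u
          simp [sqfree_apply]
        · rintro rfl
          refine ⟨∅, by simp, rfl, ?_⟩
          ext u
          simp [sqfree_apply]
      | succ k =>
        simp only [Set.mem_image, Set.mem_ofPred_eq]
        constructor
        · rintro ⟨A, hA, hc, rfl⟩
          exact ⟨_, ⟨A, hA, hc, rfl⟩, rfl⟩
        · rintro ⟨_, ⟨A, hA, hc, rfl⟩, rfl⟩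
          exact ⟨A, hA, hc, rfl⟩

end Cone

/-! ### Passing between scalar matrices and homogeneous maps over the polynomial ring -/

section Homogenization

variable {σ K : Type*} [Field K] {ι κ : Type*}

/-- The homogenization in multidegree `a` of a vector of scalars. -/
noncomputable def homogenize (t : κ → (σ →₀ ℕ)) (a : σ →₀ ℕ) :
    (κ →₀ K) →ₗ[K] (κ →₀ MvPolynomial σ K) :=
  Finsupp.lsum K fun l => Finsupp.lsingle l ∘ₗ monomial (a - t l)

theorem homogenize_single (t : κ → (σ →₀ ℕ)) (a : σ →₀ ℕ) (l : κ) (c : K) :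
    homogenize t a (Finsupp.single l c) = Finsupp.single l (monomial (a - t l) c) := by
  simp [homogenize]

theorem homogenize_apply (t : κ → (σ →₀ ℕ)) (a : σ →₀ ℕ) (v : κ →₀ K) (l : κ) :
    homogenize t a v l = monomial (a - t l) (v l) := by
  classical
  induction v using Finsupp.induction_linear with
  | zero => simp
  | add f g hf hg => simp [hf, hg]
  | single i c =>
    rw [homogenize_single, Finsupp.single_apply, Finsupp.single_apply]
    split_ifs with h
    · rw [h]
    · simp

/-- The coefficient vector of the component of multidegree `a`. -/
noncomputable def component [DecidableEq σ] (t : κ → (σ →₀ ℕ)) (a : σ →₀ ℕ) :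
    (κ →₀ MvPolynomial σ K) →ₗ[K] (κ →₀ K) :=
  Finsupp.lsum K fun l =>
    open Classical in if t l ≤ a then Finsupp.lsingle l ∘ₗ lcoeff K (a - t l) else 0

theorem component_apply [DecidableEq σ] (t : κ → (σ →₀ ℕ)) (a : σ →₀ ℕ)
    (x : κ →₀ MvPolynomial σ K) (l : κ) [Decidable (t l ≤ a)] :
    component t a x l = if t l ≤ a then coeff (a - t l) (x l) else 0 := by
  classical
  induction x using Finsupp.induction_linear with
  | zero => simp
  | add f g hf hg =>
    rw [map_add, Finsupp.add_apply, hf, hg, Finsupp.add_apply, coeff_add]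
    split_ifs <;> simp
  | single i p =>
    simp only [component, Finsupp.lsum_single]
    by_cases hi : i = l
    · subst hi
      split_ifs <;> simp
    · rw [Finsupp.single_eq_of_ne (Ne.symm hi)]
      split_ifs <;> simp [Finsupp.single_eq_of_ne (Ne.symm hi)]

theorem component_mem [DecidableEq σ] (t : κ → (σ →₀ ℕ)) (a : σ →₀ ℕ)
    (x : κ →₀ MvPolynomial σ K) : component t a x ∈ degLE K t a := by
  classical
  refine mem_degLE.2 fun l hl => ?_
  rw [component_apply] at hl
  by_contra h
  exact hl (if_neg h)

theorem component_homogenize [DecidableEq σ] {t : κ → (σ →₀ ℕ)} {a : σ →₀ ℕ} {v : κ →₀ K}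
    (hv : v ∈ degLE K t a) : component t a (homogenize t a v) = v := by
  classical
  ext l
  rw [component_apply, homogenize_apply, coeff_monomial, if_pos rfl]
  split_ifs with h
  · rfl
  · by_contra hne
    exact h (mem_degLE.1 hv l (Ne.symm hne))

theorem component_homogenize_of_ne [DecidableEq σ] {t : κ → (σ →₀ ℕ)} {a b : σ →₀ ℕ}
    (hb : b ≠ a) {v : κ →₀ K} (hv : v ∈ degLE K t b) :
    component t a (homogenize t b v) = 0 := by
  classical
  ext l
  rw [component_apply, homogenize_apply, coeff_monomial]
  by_cases hl : v l = 0
  · simp [hl]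
  · have := mem_degLE.1 hv l hl
    split_ifs with h1 h2
    · exact absurd ((tsub_left_inj this h1).1 h2) hb
    · rfl
    · rfl

theorem exists_sum_homogenize [DecidableEq σ] (t : κ → (σ →₀ ℕ)) (x : κ →₀ MvPolynomial σ K) :
    ∃ A : Finset (σ →₀ ℕ), x = ∑ a ∈ A, homogenize t a (component t a x) := by
  classical
  -- A monomial `x ^ b` in coordinate `l` has multidegree `b + t l`, so these are the only degrees
  -- that contribute.
  refine ⟨x.support.biUnion fun l => (x l).support.image fun b => b + t l, ?_⟩
  ext l b
  rw [Finsupp.finsetSum_apply, coeff_sum]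
  have hterm : ∀ a : σ →₀ ℕ, coeff b (homogenize t a (component t a x) l) =
      if a = b + t l then coeff b (x l) else 0 := by
    intro a
    rw [homogenize_apply, component_apply, coeff_monomial]
    by_cases h : a = b + t l
    · subst h
      simp
    · rw [if_neg h]
      by_cases h1 : a - t l = b
      · rw [if_pos h1, if_neg]
        intro h2
        exact h (by rw [← h1, tsub_add_cancel_of_le h2])
      · rw [if_neg h1]
  simp only [hterm]
  rw [Finset.sum_ite_eq' _ (b + t l)]
  split_ifs with h
  · rfl
  · by_contra hne
    refine h (Finset.mem_biUnion.2 ⟨l, ?_, Finset.mem_image.2 ⟨b, ?_, rfl⟩⟩)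
    · rw [Finsupp.mem_support_iff]
      intro h0
      rw [h0] at hne
      simp at hne
    · exact mem_support_iff.2 hne

/-- `d` is the homogeneous map with matrix of coefficients `D`. -/
structure IsHomogenization (s : ι → (σ →₀ ℕ)) (t : κ → (σ →₀ ℕ))
    (D : (ι →₀ K) →ₗ[K] (κ →₀ K))
    (d : (ι →₀ MvPolynomial σ K) →ₗ[MvPolynomial σ K] (κ →₀ MvPolynomial σ K)) : Prop where
  filtered : IsFiltered s t 0 D
  single_one : ∀ j, d (Finsupp.single j 1) = homogenize t (s j) (D (Finsupp.single j 1))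

namespace IsHomogenization

variable {s : ι → (σ →₀ ℕ)} {t : κ → (σ →₀ ℕ)} {D : (ι →₀ K) →ₗ[K] (κ →₀ K)}
  {d : (ι →₀ MvPolynomial σ K) →ₗ[MvPolynomial σ K] (κ →₀ MvPolynomial σ K)}

theorem map_single (h : IsHomogenization s t D d) (j : ι) (b : σ →₀ ℕ) (c : K) :
    d (Finsupp.single j (monomial b c)) =
      homogenize t (s j + b) (D (Finsupp.single j c)) := by
  have h1 : Finsupp.single j (monomial b c) =
      (monomial b c : MvPolynomial σ K) • Finsupp.single j (1 : MvPolynomial σ K) := by simp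
  have h2 : Finsupp.single j c = c • Finsupp.single j (1 : K) := by simp
  rw [h1, h2, map_smul, map_smul, h.single_one]
  ext1 l
  rw [Finsupp.smul_apply, homogenize_apply, homogenize_apply, Finsupp.smul_apply, smul_eq_mul,
    monomial_mul, smul_eq_mul]
  by_cases hl : D (Finsupp.single j 1) l = 0
  · simp [hl]
  · have := mem_degLE.1 (h.filtered j) l hl
    rw [add_zero] at this
    rw [← tsub_add_eq_add_tsub this, add_comm b]

theorem map_homogenize (h : IsHomogenization s t D d) {a : σ →₀ ℕ} {x : ι →₀ K}
    (hx : x ∈ degLE K s a) : d (homogenize s a x) = homogenize t a (D x) := by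
  have hsum : x = ∑ j ∈ x.support, Finsupp.single j (x j) := x.sum_single.symm
  rw [hsum]
  simp only [map_sum]
  refine Finset.sum_congr rfl fun j hj => ?_
  rw [homogenize_single, h.map_single,
    add_tsub_cancel_of_le (mem_degLE.1 hx j (Finsupp.mem_support_iff.1 hj))]

theorem component_map [DecidableEq σ] (h : IsHomogenization s t D d) (a : σ →₀ ℕ)
    (x : ι →₀ MvPolynomial σ K) : component t a (d x) = D (component s a x) := by
  classical
  obtain ⟨A, hA⟩ := exists_sum_homogenize s x
  have hD : ∀ b (v : ι →₀ K), v ∈ degLE K s b → D v ∈ degLE K t b := fun b v hv => by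
    simpa using h.filtered.map_mem hv
  rw [hA]
  simp only [map_sum]
  refine Finset.sum_congr rfl fun b _ => ?_
  have hmem := component_mem s b x
  rw [h.map_homogenize hmem]
  by_cases hb : b = a
  · subst hb
    rw [component_homogenize hmem, component_homogenize (hD _ _ hmem)]
  · rw [component_homogenize_of_ne hb hmem,
      component_homogenize_of_ne hb (hD _ _ hmem), map_zero]

/-- Homogeneous maps commute with taking components, so exactness can be tested in one multidegree
at a time, and the strand in degree `a` is the scalar complex on `degLE K _ a`. -/
theorem exact {τ : Type*} {u : τ → (σ →₀ ℕ)} {D' : (κ →₀ K) →ₗ[K] (τ →₀ K)}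
    {d' : (κ →₀ MvPolynomial σ K) →ₗ[MvPolynomial σ K] (τ →₀ MvPolynomial σ K)}
    (h : IsHomogenization s t D d) (h' : IsHomogenization t u D' d')
    (hDD : ∀ x, D' (D x) = 0)
    (hex : ∀ a, ∀ x ∈ degLE K t a, D' x = 0 → ∃ y ∈ degLE K s a, D y = x) :
    Function.Exact d d' := by
  classical
  intro x
  constructor
  · intro hx
    have hcomp : ∀ a, ∃ y ∈ degLE K s a, D y = component t a x := fun a =>
      hex a _ (component_mem t a x) (by rw [← h'.component_map, hx, map_zero])
    choose y hy hDy using hcomp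
    obtain ⟨A, hA⟩ := exists_sum_homogenize t x
    refine ⟨∑ a ∈ A, homogenize s a (y a), ?_⟩
    rw [map_sum, hA]
    refine Finset.sum_congr rfl fun a _ => ?_
    rw [h.map_homogenize (hy a), hDy]
  · rintro ⟨y, rfl⟩
    obtain ⟨A, hA⟩ := exists_sum_homogenize s y
    rw [hA, map_sum, map_sum]
    refine Finset.sum_eq_zero fun a _ => ?_
    have hmem := component_mem s a y
    have := h.filtered.map_mem hmem
    rw [add_zero] at this
    rw [h.map_homogenize hmem, h'.map_homogenize this, hDD, map_zero]

end IsHomogenization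

/-- The homogeneous map with a given matrix of coefficients. -/
noncomputable def homogenizeMap (s : ι → (σ →₀ ℕ)) (t : κ → (σ →₀ ℕ))
    (D : (ι →₀ K) →ₗ[K] (κ →₀ K)) :
    (ι →₀ MvPolynomial σ K) →ₗ[MvPolynomial σ K] (κ →₀ MvPolynomial σ K) :=
  Finsupp.linearCombination _ fun j => homogenize t (s j) (D (Finsupp.single j 1))

theorem isHomogenization_homogenizeMap {s : ι → (σ →₀ ℕ)} {t : κ → (σ →₀ ℕ)}
    {D : (ι →₀ K) →ₗ[K] (κ →₀ K)} (h : IsFiltered s t 0 D) :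
    IsHomogenization s t D (homogenizeMap s t D) :=
  ⟨h, fun j => by simp [homogenizeMap]⟩

/-- The matrix of coefficients of a homogeneous map. -/
noncomputable def dehomogenizeMap [DecidableEq σ] (s : ι → (σ →₀ ℕ)) (t : κ → (σ →₀ ℕ))
    (d : (ι →₀ MvPolynomial σ K) →ₗ[MvPolynomial σ K] (κ →₀ MvPolynomial σ K)) :
    (ι →₀ K) →ₗ[K] (κ →₀ K) :=
  Finsupp.linearCombination _ fun j => component t (s j) (d (Finsupp.single j 1))

theorem isHomogenization_dehomogenizeMap [DecidableEq σ] {s : ι → (σ →₀ ℕ)} {t : κ → (σ →₀ ℕ)}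
    {d : (ι →₀ MvPolynomial σ K) →ₗ[MvPolynomial σ K] (κ →₀ MvPolynomial σ K)}
    (h : ∀ j l, ∃ c : K, monomial (t l) 1 * d (Finsupp.single j 1) l = monomial (s j) c) :
    IsHomogenization s t (dehomogenizeMap s t d) d := by
  classical
  refine ⟨fun j => ?_, fun j => ?_⟩
  · simpa [dehomogenizeMap] using component_mem t (s j) (d (Finsupp.single j 1))
  · ext1 l
    rw [homogenize_apply, dehomogenizeMap, Finsupp.linearCombination_single, one_smul,
      component_apply]
    obtain ⟨c, hc⟩ := h j l
    have hinj : ∀ p q : MvPolynomial σ K, monomial (t l) 1 * p = monomial (t l) 1 * q → p = q :=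
      fun p q hpq => mul_left_cancel₀ (by simp) hpq
    split_ifs with hle
    · have hp : d (Finsupp.single j 1) l = monomial (s j - t l) c := by
        refine hinj _ _ ?_
        rw [hc, monomial_mul, one_mul, add_tsub_cancel_of_le hle]
      rw [hp, coeff_monomial, if_pos rfl]
    · have hc0 : c = 0 := by
        have := congrArg (coeff (s j)) hc
        rwa [coeff_monomial_mul', if_neg hle, coeff_monomial, if_pos rfl, eq_comm] at this
      refine hinj _ _ ?_
      rw [hc, hc0]
      simp

end Homogenization

/-! ### Minimal free resolutions and homological shift ideals -/

section Minimal

variable {σ K : Type*} [Field K]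

theorem apply_mem_of_mem_smul_top {R κ : Type*} [CommRing R] (J : Ideal R) {x : κ →₀ R}
    (hx : x ∈ J • (⊤ : Submodule R (κ →₀ R))) (l : κ) : x l ∈ J := by
  refine Submodule.smul_induction_on hx (fun r hr y _ => ?_) fun y z hy hz => ?_
  · exact J.mul_mem_right _ hr
  · exact J.add_mem hy hz

theorem mem_smul_top_of_forall_apply_mem {R κ : Type*} [CommRing R] (J : Ideal R) {x : κ →₀ R}
    (hx : ∀ l, x l ∈ J) : x ∈ J • (⊤ : Submodule R (κ →₀ R)) := by
  rw [← x.sum_single]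
  refine Submodule.sum_mem _ fun l _ => ?_
  have : Finsupp.single l (x l) = x l • Finsupp.single l (1 : R) := by simp
  rw [this]
  exact Submodule.smul_mem_smul (hx l) trivial

theorem coeff_zero_of_mem_span_X {p : MvPolynomial σ K}
    (hp : p ∈ Ideal.span (Set.range (X : σ → MvPolynomial σ K))) : coeff 0 p = 0 := by
  have hle : Ideal.span (Set.range (X : σ → MvPolynomial σ K)) ≤
      RingHom.ker (constantCoeff (σ := σ) (R := K)) := by
    rw [Ideal.span_le]
    rintro _ ⟨v, rfl⟩
    simp
  have := hle hp
  rwa [RingHom.mem_ker, constantCoeff_eq] at this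

theorem monomial_mem_span_X {a : σ →₀ ℕ} (ha : a ≠ 0) (c : K) :
    monomial a c ∈ Ideal.span (Set.range (X : σ → MvPolynomial σ K)) := by
  obtain ⟨v, hv⟩ := Finsupp.ne_iff.1 ha
  have h1 : monomial a c = monomial (a - Finsupp.single v 1) c * X v := by
    rw [X, monomial_mul, mul_one, tsub_add_cancel_of_le]
    exact Finsupp.single_le_iff.2 (Nat.one_le_iff_ne_zero.2 hv)
  rw [h1]
  exact Ideal.mul_mem_left _ _ (Ideal.subset_span ⟨v, rfl⟩)

namespace MinimalFreeResolution

variable {I : Ideal (MvPolynomial σ K)} (F : MinimalFreeResolution I)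

/-- The index sets of the augmented resolution. -/
def augIndex : ℕ → Type
  | 0 => Unit
  | k + 1 => F.index k

/-- The shifts of the augmented resolution. -/
noncomputable def augShift : ∀ k, F.augIndex k → (σ →₀ ℕ)
  | 0 => fun _ => 0
  | k + 1 => F.shift k

/-- The differential of the augmented resolution. -/
noncomputable def augD : ∀ k, (F.augIndex (k + 1) →₀ MvPolynomial σ K) →ₗ[MvPolynomial σ K]
    (F.augIndex k →₀ MvPolynomial σ K)
  | 0 => Finsupp.lsingle () ∘ₗ F.aug
  | k + 1 => F.d k

theorem augD_homogeneous (k : ℕ) (j : F.augIndex (k + 1)) (l : F.augIndex k) : ∃ c : K,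
    monomial (F.augShift k l) 1 * F.augD k (Finsupp.single j 1) l =
      monomial (F.augShift (k + 1) j) c := by
  cases k with
  | zero =>
    obtain ⟨c, hc⟩ := F.aug_homogeneous j
    refine ⟨c, ?_⟩
    change monomial 0 1 * (Finsupp.single () (F.aug (Finsupp.single j 1)) : Unit →₀ _) () = _
    rw [hc, Finsupp.single_eq_same, monomial_mul, zero_add, one_mul]
    rfl
  | succ k => exact F.d_homogeneous k j l

theorem augD_exact (k : ℕ) : Function.Exact (F.augD (k + 1)) (F.augD k) := by
  cases k with
  | zero =>
    intro x
    rw [← show _ ↔ x ∈ Set.range (F.augD 1) from F.exact_zero x]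
    change (Finsupp.single () (F.aug x) : Unit →₀ _) = 0 ↔ _
    rw [Finsupp.single_eq_zero]
  | succ k => exact F.exact k

theorem isHomogenization_augD [DecidableEq σ] (k : ℕ) :
    IsHomogenization (F.augShift (k + 1)) (F.augShift k)
      (dehomogenizeMap (F.augShift (k + 1)) (F.augShift k) (F.augD k)) (F.augD k) :=
  isHomogenization_dehomogenizeMap (F.augD_homogeneous k)

/-- The filtered model of a multigraded minimal free resolution. -/
noncomputable def toFiltered [DecidableEq σ] :
    FilteredResolution K {a : σ →₀ ℕ | monomial a (1 : K) ∈ I} where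
  idx := F.augIndex
  finite_idx k := by
    cases k with
    | zero => exact inferInstanceAs (Finite Unit)
    | succ k => exact F.finite_index k
  sh := F.augShift
  D k := dehomogenizeMap (F.augShift (k + 1)) (F.augShift k) (F.augD k)
  filtered k := (F.isHomogenization_augD k).filtered
  D_D k x := by
    have h := F.isHomogenization_augD
    induction x using Finsupp.induction_linear with
    | zero => simp
    | add x y hx hy => rw [map_add, map_add, hx, hy, add_zero]
    | single j c =>
      have hj := single_mem_degLE (K := K) (F.augShift (k + 2)) j c
      rw [← component_homogenize hj, ← (h (k + 1)).component_map, ← (h k).component_map,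
        (F.augD_exact k).apply_apply_eq_zero, map_zero]
  exact k a x hx hD := by
    have h := F.isHomogenization_augD
    obtain ⟨y, hy⟩ := (F.augD_exact k (homogenize _ a x)).1 (by
      rw [(h k).map_homogenize hx, hD, map_zero])
    refine ⟨component _ a y, component_mem _ a y, ?_⟩
    rw [← (h (k + 1)).component_map, hy, component_homogenize hx]
  zero := ()
  eq_zero _ := rfl
  sh_zero := rfl
  mem_iff a := by
    have h := F.isHomogenization_augD 0
    rw [Set.mem_ofPred_eq]
    have h0 : homogenize (F.augShift 0) a (Finsupp.single () (1 : K)) =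
        Finsupp.single () (monomial a 1) := by
      refine (homogenize_single _ _ _ _).trans ?_
      change Finsupp.single () (monomial (a - 0) 1) = _
      rw [tsub_zero]
    constructor
    · intro ha
      rw [← F.range_aug] at ha
      obtain ⟨x, hx⟩ := ha
      refine ⟨component (F.augShift 1) a x, component_mem _ a x, ?_⟩
      refine (h.component_map a x).symm.trans ?_
      change component _ a (Finsupp.single () (F.aug x)) = _
      rw [hx, ← h0]
      refine component_homogenize (degLE_mono _ ?_ (single_mem_degLE _ _ _))
      exact zero_le
    · rintro ⟨y, hy, hD⟩
      rw [← F.range_aug]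
      refine ⟨homogenize (F.augShift 1) a y, ?_⟩
      have := h.map_homogenize hy
      rw [hD, h0] at this
      exact Finsupp.single_injective () this

/-- Between basis elements of equal multidegree the matrix entry is a constant, and minimality puts
it in the ideal of the variables, so it is zero. -/
theorem toFiltered_minimal [DecidableEq σ] (k : ℕ) (j : F.toFiltered.idx (k + 2))
    (l : F.toFiltered.idx (k + 1)) (h : F.toFiltered.sh (k + 2) j = F.toFiltered.sh (k + 1) l) :
    F.toFiltered.D (k + 1) (Finsupp.single j 1) l = 0 := by
  have h1 : F.d k (Finsupp.single j 1) l ∈ Ideal.span (Set.range (X : σ → MvPolynomial σ K)) :=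
    apply_mem_of_mem_smul_top _ (F.minimal k ⟨_, rfl⟩) l
  have h2 := (DFunLike.congr_fun ((F.isHomogenization_augD (k + 1)).single_one j) l).trans
    (homogenize_apply _ _ _ _)
  have h3 := (congrArg (coeff 0) h2).symm.trans (coeff_zero_of_mem_span_X h1)
  rw [coeff_monomial, if_pos] at h3
  · exact h3
  · exact tsub_eq_zero_of_le h.le

end MinimalFreeResolution

/-- If shifts in consecutive degrees never coincide, every nonzero entry of the homogenized
differential is a multiple of a nonconstant monomial, and minimality is automatic. -/
theorem FilteredResolution.exists_minimalFreeResolution {I : Ideal (MvPolynomial σ K)}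
    {U : Set (σ →₀ ℕ)} (hI : ∀ p, p ∈ I ↔ ∀ b ∈ p.support, b ∈ U) (G : FilteredResolution K U)
    (hmin : ∀ k j l, G.sh (k + 2) j ≠ G.sh (k + 1) l) (k : ℕ) (j : G.idx (k + 1)) :
    ∃ (F : MinimalFreeResolution I) (i : F.index k), F.shift k i = G.sh (k + 1) j := by
  classical
  have h := fun k => isHomogenization_homogenizeMap (G.filtered k)
  let aug : (G.idx 1 →₀ MvPolynomial σ K) →ₗ[MvPolynomial σ K] MvPolynomial σ K :=
    Finsupp.lapply G.zero ∘ₗ homogenizeMap (G.sh 1) (G.sh 0) (G.D 0)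
  have haug : ∀ x, homogenizeMap (G.sh 1) (G.sh 0) (G.D 0) x = 0 ↔ aug x = 0 := by
    intro x
    constructor
    · intro hx
      change (homogenizeMap (G.sh 1) (G.sh 0) (G.D 0) x) G.zero = 0
      rw [hx]
      rfl
    · intro hx
      ext1 l
      rw [G.eq_zero l]
      exact hx
  have haug' : ∀ a, ∀ y ∈ degLE K (G.sh 1) a, aug (homogenize (G.sh 1) a y) =
      monomial a (G.D 0 y G.zero) := by
    intro a y hy
    change homogenizeMap (G.sh 1) (G.sh 0) (G.D 0) (homogenize (G.sh 1) a y) G.zero = _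
    rw [(h 0).map_homogenize hy, homogenize_apply, G.sh_zero, tsub_zero]
  have haug1 : ∀ l, aug (Finsupp.single l 1) =
      monomial (G.sh 1 l) (G.D 0 (Finsupp.single l 1) G.zero) := by
    intro l
    rw [← haug' _ _ (single_mem_degLE (G.sh 1) l 1), homogenize_single, tsub_self]
    rfl
  refine ⟨{
    index := fun k => G.idx (k + 1)
    finite_index := fun k => G.finite_idx (k + 1)
    shift := fun k => G.sh (k + 1)
    d := fun k => homogenizeMap (G.sh (k + 2)) (G.sh (k + 1)) (G.D (k + 1))
    aug := aug
    d_homogeneous := fun k j l => ?_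
    aug_homogeneous := fun l => ⟨_, haug1 l⟩
    exact := fun k => (h (k + 2)).exact (h (k + 1)) (G.D_D (k + 1)) (G.exact (k + 1))
    exact_zero := fun x => (haug x).symm.trans
      ((h 1).exact (h 0) (G.D_D 0) (G.exact 0) x)
    range_aug := le_antisymm ?_ ?_
    minimal := fun k => ?_ }, j, rfl⟩
  · refine ⟨G.D (k + 1) (Finsupp.single j 1) l, ?_⟩
    rw [(h (k + 1)).single_one, homogenize_apply, monomial_mul, one_mul]
    by_cases hl : G.D (k + 1) (Finsupp.single j 1) l = 0
    · rw [hl, map_zero, map_zero]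
    · have := mem_degLE.1 (G.filtered (k + 1) j) l hl
      rw [add_zero] at this
      rw [add_tsub_cancel_of_le this]
  · rintro _ ⟨x, rfl⟩
    induction x using Finsupp.induction_linear with
    | zero => simp
    | add x y hx hy => rw [map_add]; exact I.add_mem hx hy
    | single l p =>
      have : Finsupp.single l p = p • Finsupp.single l (1 : MvPolynomial σ K) := by simp
      rw [this, map_smul, haug1]
      refine I.mul_mem_left _ ((hI _).2 fun b hb => ?_)
      rw [mem_support_iff, coeff_monomial] at hb
      split_ifs at hb with hb'
      · rw [← hb']
        exact G.mem_of_D_zero_ne (single_mem_degLE (G.sh 1) l 1) hb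
      · exact absurd rfl hb
  · intro p hp
    rw [p.as_sum]
    refine Submodule.sum_mem _ fun a ha => ?_
    obtain ⟨y, hy, hD⟩ := (G.mem_iff a).1 ((hI p).1 hp a ha)
    refine ⟨(C (coeff a p) : MvPolynomial σ K) • homogenize (G.sh 1) a y, ?_⟩
    rw [map_smul, haug' a y hy, hD, Finsupp.single_eq_same, smul_eq_mul, C_mul_monomial, mul_one]
  · rintro _ ⟨x, rfl⟩
    induction x using Finsupp.induction_linear with
    | zero => simp
    | add x y hx hy => rw [map_add]; exact Submodule.add_mem _ hx hy
    | single j p =>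
      have : Finsupp.single j p = p • Finsupp.single j (1 : MvPolynomial σ K) := by simp
      rw [this, map_smul]
      refine Submodule.smul_mem _ _ (mem_smul_top_of_forall_apply_mem _ fun l => ?_)
      rw [(h (k + 1)).single_one, homogenize_apply]
      by_cases hl : G.D (k + 1) (Finsupp.single j 1) l = 0
      · rw [hl, map_zero]
        exact Submodule.zero_mem _
      · have hle := mem_degLE.1 (G.filtered (k + 1) j) l hl
        rw [add_zero] at hle
        refine monomial_mem_span_X (fun h0 => ?_) _
        exact hmin k j l (le_antisymm (tsub_eq_zero_iff_le.1 h0) hle)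

/-- The homological shift ideals of a monomial ideal can be read off from any filtered resolution
whose shifts in different homological degrees are different. -/
theorem HS_eq_of_hasShifts {I : Ideal (MvPolynomial σ K)} {U : Set (σ →₀ ℕ)}
    (hI : ∀ p, p ∈ I ↔ ∀ b ∈ p.support, b ∈ U) {B : ℕ → Set (σ →₀ ℕ)} (hB : HasShifts K U B)
    (hdisj : ∀ k, Disjoint (B (k + 1)) (B k)) (k : ℕ) :
    HS k I = Ideal.span ((fun a => monomial a (1 : K)) '' B k) := by
  classical
  obtain ⟨G, -, hG⟩ := hB
  have hU : U = {a : σ →₀ ℕ | monomial a (1 : K) ∈ I} := by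
    ext a
    rw [Set.mem_ofPred_eq, hI]
    simp [support_monomial]
  subst hU
  unfold HS
  congr 1
  ext p
  constructor
  -- An arbitrary minimal resolution has no shifts beyond those of `G`; conversely, `G` itself
  -- homogenizes to a minimal resolution.
  · rintro ⟨F, j, rfl⟩
    obtain ⟨l, hl⟩ := F.toFiltered.exists_sh_eq G F.toFiltered_minimal k j
    refine ⟨F.shift k j, ?_, rfl⟩
    rw [← hG k]
    exact ⟨l, hl⟩
  · rintro ⟨a, ha, rfl⟩
    rw [← hG k] at ha
    obtain ⟨j, rfl⟩ := ha
    obtain ⟨F, i, hi⟩ := G.exists_minimalFreeResolution hI (fun k j l h => by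
      have h1 : G.sh (k + 2) j ∈ B (k + 1) := by rw [← hG]; exact ⟨j, rfl⟩
      have h2 : G.sh (k + 1) l ∈ B k := by rw [← hG]; exact ⟨l, rfl⟩
      exact Set.disjoint_left.1 (hdisj k) h1 (h ▸ h2)) k j
    exact ⟨F, i, by rw [hi]⟩

end Minimal

/-! ### Edge ideals of complements of chordal graphs -/

section Squarefree

variable {σ K : Type*} [Field K]

theorem sqfree_le_iff {A : Finset σ} {a : σ →₀ ℕ} : sqfree A ≤ a ↔ ∀ v ∈ A, a v ≠ 0 := by
  classical
  simp only [Finsupp.le_def, sqfree_apply]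
  refine forall_congr' fun v => ?_
  by_cases h : v ∈ A <;> simp [h, Nat.one_le_iff_ne_zero]

theorem sqfree_apply_ne_zero {A : Finset σ} {v : σ} : sqfree A v ≠ 0 ↔ v ∈ A := by
  classical
  simp [sqfree_apply]

theorem sqfree_le_sqfree {A B : Finset σ} : sqfree A ≤ sqfree B ↔ A ⊆ B := by
  simp only [sqfree_le_iff, sqfree_apply_ne_zero, Finset.subset_iff]

theorem sqfree_injective : Function.Injective (sqfree : Finset σ → σ →₀ ℕ) := fun _ _ h =>
  (sqfree_le_sqfree.1 h.le).antisymm (sqfree_le_sqfree.1 h.ge)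

theorem sqfree_add_sqfree [DecidableEq σ] {A B : Finset σ} (h : Disjoint A B) :
    sqfree A + sqfree B = sqfree (A ∪ B) := by
  ext v
  simp only [Finsupp.add_apply, sqfree_apply, Finset.mem_union]
  by_cases hA : v ∈ A
  · simp [hA, Finset.disjoint_left.1 h hA]
  · simp [hA]

theorem X_mul_X_eq_monomial_sqfree [DecidableEq σ] {u v : σ} (h : u ≠ v) :
    (X u * X v : MvPolynomial σ K) = monomial (sqfree {u, v}) 1 := by
  suffices h : Finsupp.single u 1 + Finsupp.single v 1 = sqfree {u, v} by
    rw [X, X, monomial_mul, one_mul, h]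
  ext w
  simp only [Finsupp.add_apply, Finsupp.single_apply, sqfree_apply, Finset.mem_insert,
    Finset.mem_singleton]
  by_cases h1 : u = w
  · have h2 : v ≠ w := fun h2 => h (h1.trans h2.symm)
    simp [h1, h2]
  · by_cases h2 : v = w
    · simp [h1, h2]
    · simp [h1, h2, Ne.symm h1, Ne.symm h2]

/-- Besides the largest one, some element of `W` has no larger neighbour in `W`. If the larger
neighbours of every vertex form a clique, this says that `W` induces a disconnected subgraph. -/
def SimpleGraph.Splits [LinearOrder σ] (Γ : SimpleGraph σ) (W : Finset σ) : Prop :=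
  ∃ v ∈ W, (∃ u ∈ W, v < u) ∧ ∀ u ∈ W, v < u → ¬ Γ.Adj v u

variable [LinearOrder σ] {Γ : SimpleGraph σ}

/-- The non-edges `v < u` in lexicographic order give linear quotients: the colon at `(v, u)` is
generated by the `x_w` with `w < v`, or with `v < w < u` and `w` not adjacent to `v`. For `w < v`,
if `w` is adjacent to `v` then it cannot be adjacent to `u` as well, since `v` and `u` would then be
adjacent; so `(w, v)` or `(w, u)` is an earlier non-edge. Adding a set `A` of such `w` to `{v, u}`
gives a set with maximum `u` in which `v` has no larger neighbour. -/
theorem hasShifts_edgeIdeal_compl [Fintype σ]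
    (hΓ : ∀ w u v, w < u → w < v → u ≠ v → Γ.Adj w u → Γ.Adj w v → Γ.Adj u v) :
    HasShifts K {a : σ →₀ ℕ | ∃ v u, v < u ∧ ¬ Γ.Adj v u ∧ sqfree {v, u} ≤ a}
      fun k => sqfree '' {W | W.card = k + 2 ∧ Γ.Splits W} := by
  classical
  let E : Finset (σ ×ₗ σ) := Finset.univ.filter fun g =>
    (ofLex g).1 < (ofLex g).2 ∧ ¬ Γ.Adj (ofLex g).1 (ofLex g).2
  let T : σ ×ₗ σ → Finset σ := fun g => Finset.univ.filter fun w =>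
    w < (ofLex g).1 ∨ ((ofLex g).1 < w ∧ w < (ofLex g).2 ∧ ¬ Γ.Adj (ofLex g).1 w)
  let m : σ ×ₗ σ → (σ →₀ ℕ) := fun g => sqfree {(ofLex g).1, (ofLex g).2}
  have hE : ∀ v u, toLex (v, u) ∈ E ↔ v < u ∧ ¬ Γ.Adj v u := fun v u => by simp [E]
  have hT : ∀ v u w, w ∈ T (toLex (v, u)) ↔ w < v ∨ (v < w ∧ w < u ∧ ¬ Γ.Adj v w) :=
    fun v u w => by
      change w ∈ Finset.univ.filter _ ↔ _
      rw [Finset.mem_filter]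
      simp
  have hm : ∀ v u a v' u', m (toLex (v', u')) ≤ a + m (toLex (v, u)) ↔
      (a v' ≠ 0 ∨ v' = v ∨ v' = u) ∧ (a u' ≠ 0 ∨ u' = v ∨ u' = u) := by
    intro v u a v' u'
    have hadd : ∀ w, (a + m (toLex (v, u))) w ≠ 0 ↔ a w ≠ 0 ∨ w = v ∨ w = u := by
      intro w
      have : m (toLex (v, u)) w ≠ 0 ↔ w = v ∨ w = u := by
        change sqfree {v, u} w ≠ 0 ↔ _
        rw [sqfree_apply_ne_zero]
        simp
      rw [← this, Finsupp.add_apply]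
      omega
    change sqfree {v', u'} ≤ _ ↔ _
    rw [sqfree_le_iff]
    simp only [Finset.mem_insert, Finset.mem_singleton, forall_eq_or_imp, forall_eq, hadd]
  have key := hasShifts_of_linearQuotients (K := K) m T E (by
    rintro ⟨v, u⟩ hg a
    obtain ⟨hvu, hnadj⟩ := (hE v u).1 hg
    constructor
    · rintro ⟨⟨v', u'⟩, hg', hlt, hle⟩
      obtain ⟨hvu', hnadj'⟩ := (hE v' u').1 hg'
      obtain ⟨h1, h2⟩ := (hm v u a v' u').1 hle
      rcases Prod.Lex.toLex_lt_toLex.1 hlt with h | ⟨h, h'⟩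
      · refine ⟨v', (hT v u v').2 (Or.inl h), ?_⟩
        rcases h1 with h1 | h1 | h1
        · exact h1
        · exact absurd h1 h.ne
        · exact absurd h1 (h.trans hvu).ne
      · simp only at h h'
        subst h
        refine ⟨u', (hT _ u u').2 (Or.inr ⟨hvu', h', hnadj'⟩), ?_⟩
        rcases h2 with h2 | h2 | h2
        · exact h2
        · exact absurd h2 hvu'.ne'
        · exact absurd h2 h'.ne
    · rintro ⟨w, hw, hwa⟩
      rcases (hT v u w).1 hw with hwv | ⟨hvw, hwu, hnw⟩
      · by_cases hadj : Γ.Adj w v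
        · refine ⟨toLex (w, u), (hE w u).2 ⟨hwv.trans hvu, fun h => ?_⟩,
            Prod.Lex.toLex_lt_toLex.2 (Or.inl hwv),
            (hm v u a w u).2 ⟨Or.inl hwa, Or.inr (Or.inr rfl)⟩⟩
          exact hnadj (hΓ w v u hwv (hwv.trans hvu) hvu.ne hadj h)
        · exact ⟨toLex (w, v), (hE w v).2 ⟨hwv, hadj⟩, Prod.Lex.toLex_lt_toLex.2 (Or.inl hwv),
            (hm v u a w v).2 ⟨Or.inl hwa, Or.inr (Or.inl rfl)⟩⟩
      · exact ⟨toLex (v, w), (hE v w).2 ⟨hvw, hnw⟩,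
          Prod.Lex.toLex_lt_toLex.2 (Or.inr ⟨rfl, hwu⟩),
          (hm v u a v w).2 ⟨Or.inr (Or.inl rfl), Or.inl hwa⟩⟩)
  convert key using 1
  · ext a
    constructor
    · rintro ⟨v, u, hvu, hadj, hle⟩
      exact ⟨toLex (v, u), (hE v u).2 ⟨hvu, hadj⟩, hle⟩
    · rintro ⟨⟨v, u⟩, hg, hle⟩
      obtain ⟨hvu, hadj⟩ := (hE v u).1 hg
      exact ⟨v, u, hvu, hadj, hle⟩
  · ext k b
    constructor
    · rintro ⟨W, ⟨hcard, v, hv, ⟨u₀, hu₀, hvu₀⟩, hW⟩, rfl⟩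
      -- A splitting set comes from the non-edge formed by its witness `v` and its maximum `u`; all
      -- other elements are colon variables of that generator.
      obtain ⟨u, hu, hmax⟩ := W.exists_max_image id ⟨v, hv⟩
      have hvu : v < u := hvu₀.trans_le (hmax u₀ hu₀)
      have hsub : ({v, u} : Finset σ) ⊆ W := by
        rw [Finset.insert_subset_iff, Finset.singleton_subset_iff]
        exact ⟨hv, hu⟩
      refine ⟨toLex (v, u), (hE v u).2 ⟨hvu, hW u hu hvu⟩, W \ {v, u}, ?_, ?_, ?_⟩
      · intro w hw
        rw [Finset.mem_sdiff, Finset.mem_insert, Finset.mem_singleton, not_or] at hw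
        refine (hT v u w).2 ?_
        rcases lt_or_gt_of_ne hw.2.1 with h | h
        · exact Or.inl h
        · exact Or.inr ⟨h, lt_of_le_of_ne (hmax w hw.1) hw.2.2, hW w hw.1 h⟩
      · rw [Finset.card_sdiff_of_subset hsub, Finset.card_pair hvu.ne, hcard]
        rfl
      · change _ = _ + sqfree {v, u}
        rw [sqfree_add_sqfree Finset.sdiff_disjoint, Finset.sdiff_union_of_subset hsub]
    · rintro ⟨⟨v, u⟩, hg, A, hA, hcard, rfl⟩
      obtain ⟨hvu, hadj⟩ := (hE v u).1 hg
      have hdisj : Disjoint A {v, u} := by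
        rw [Finset.disjoint_left]
        intro w hw hw'
        rw [Finset.mem_insert, Finset.mem_singleton] at hw'
        rcases (hT v u w).1 (hA hw) with h | ⟨h1, h2, -⟩
        · rcases hw' with rfl | rfl
          · exact lt_irrefl _ h
          · exact lt_asymm h hvu
        · rcases hw' with rfl | rfl
          · exact lt_irrefl _ h1
          · exact lt_irrefl _ h2
      refine ⟨A ∪ {v, u}, ⟨?_, v, by simp, ⟨u, by simp, hvu⟩, ?_⟩, (sqfree_add_sqfree hdisj).symm⟩
      · rw [Finset.card_union_of_disjoint hdisj, Finset.card_pair hvu.ne, hcard]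
      · intro w hw hvw
        rw [Finset.mem_union, Finset.mem_insert, Finset.mem_singleton] at hw
        rcases hw with hw | rfl | rfl
        · rcases (hT v u w).1 (hA hw) with h | h
          · exact absurd h hvw.not_gt
          · exact h.2.2
        · exact absurd hvw (lt_irrefl _)
        · exact hadj

theorem mem_edgeIdeal_compl_iff (p : MvPolynomial σ K) :
    p ∈ edgeIdeal K Γᶜ ↔ ∀ b ∈ p.support,
      b ∈ {a : σ →₀ ℕ | ∃ v u, v < u ∧ ¬ Γ.Adj v u ∧ sqfree {v, u} ≤ a} := by
  have h : edgeIdeal K Γᶜ = Ideal.span ((fun a => monomial a (1 : K)) ''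
      {a | ∃ v u, v < u ∧ ¬ Γ.Adj v u ∧ a = sqfree {v, u}}) := by
    unfold edgeIdeal
    congr 1
    ext p
    constructor
    · rintro ⟨u, v, huv, rfl⟩
      rw [SimpleGraph.compl_adj] at huv
      rcases lt_or_gt_of_ne huv.1 with hlt | hlt
      · exact ⟨_, ⟨u, v, hlt, huv.2, rfl⟩, (X_mul_X_eq_monomial_sqfree huv.1).symm⟩
      · refine ⟨_, ⟨v, u, hlt, fun h => huv.2 h.symm, rfl⟩, ?_⟩
        rw [mul_comm]
        exact (X_mul_X_eq_monomial_sqfree huv.1.symm).symm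
    · rintro ⟨_, ⟨v, u, hlt, hadj, rfl⟩, rfl⟩
      refine ⟨v, u, ?_, (X_mul_X_eq_monomial_sqfree hlt.ne).symm⟩
      rw [SimpleGraph.compl_adj]
      exact ⟨hlt.ne, hadj⟩
  rw [h, mem_ideal_span_monomial_image]
  refine forall₂_congr fun b _ => ?_
  constructor
  · rintro ⟨_, ⟨v, u, h1, h2, rfl⟩, h3⟩
    exact ⟨v, u, h1, h2, h3⟩
  · rintro ⟨v, u, h1, h2, h3⟩
    exact ⟨_, ⟨v, u, h1, h2, rfl⟩, h3⟩

/-- The homological shift ideals of the edge ideal of the complement of a chordal graph. -/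
theorem HS_edgeIdeal_compl [Fintype σ]
    (hΓ : ∀ w u v, w < u → w < v → u ≠ v → Γ.Adj w u → Γ.Adj w v → Γ.Adj u v) (k : ℕ) :
    HS k (edgeIdeal K Γᶜ) = Ideal.span ((fun a => monomial a (1 : K)) ''
      (sqfree '' {W | W.card = k + 2 ∧ Γ.Splits W})) := by
  refine HS_eq_of_hasShifts mem_edgeIdeal_compl_iff (hasShifts_edgeIdeal_compl hΓ)
    (fun k => ?_) k
  rw [Set.disjoint_left]
  rintro _ ⟨W, ⟨hW, -⟩, rfl⟩ ⟨W', ⟨hW', -⟩, h⟩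
  rw [sqfree_injective h] at hW'
  omega

end Squarefree

/-! ### Criteria for and against linear quotients -/

section LinearQuotients

variable {σ K : Type*} [Field K]

theorem mem_span_monomial_colon (B : Set (σ →₀ ℕ)) (m : σ →₀ ℕ) (p : MvPolynomial σ K) :
    p ∈ (Ideal.span ((fun a => monomial a (1 : K)) '' B)).colon {monomial m (1 : K)} ↔
      ∀ b ∈ p.support, ∃ a ∈ B, a ≤ b + m := by
  classical
  rw [Submodule.mem_colon_singleton, smul_eq_mul, mem_ideal_span_monomial_image]
  constructor
  · intro h b hb
    refine h (b + m) ?_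
    rw [mem_support_iff] at hb ⊢
    rwa [coeff_mul_monomial, mul_one]
  · intro h c hc
    rw [mem_support_iff, coeff_mul_monomial'] at hc
    split_ifs at hc with hle
    · rw [mul_one] at hc
      obtain ⟨a, ha, hab⟩ := h (c - m) (mem_support_iff.2 hc)
      rw [tsub_add_cancel_of_le hle] at hab
      exact ⟨a, ha, hab⟩
    · exact absurd rfl hc

theorem mingens_span_sqfree {𝒲 : Set (Finset σ)} {s : ℕ} (h𝒲 : ∀ W ∈ 𝒲, W.card = s) :
    mingens (Ideal.span ((fun a => monomial a (1 : K)) '' (sqfree '' 𝒲))) = sqfree '' 𝒲 := by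
  classical
  have hmem : ∀ b, monomial b (1 : K) ∈ Ideal.span ((fun a => monomial a (1 : K)) ''
      (sqfree '' 𝒲)) ↔ ∃ W ∈ 𝒲, sqfree W ≤ b := by
    intro b
    rw [mem_ideal_span_monomial_image]
    simp [support_monomial]
  ext a
  simp only [mingens, hmem]
  constructor
  · rintro ⟨⟨W, hW, hle⟩, hmin⟩
    exact ⟨W, hW, le_antisymm hle (hmin ⟨W, hW, le_rfl⟩ hle)⟩
  · rintro ⟨W, hW, rfl⟩
    refine ⟨⟨W, hW, le_rfl⟩, ?_⟩
    rintro b ⟨W', hW', hle⟩ hb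
    have := Finset.eq_of_subset_of_card_le (sqfree_le_sqfree.1 (hle.trans hb))
      ((h𝒲 W hW).trans (h𝒲 W' hW').symm).le
    exact this ▸ hle

theorem setOf_exists_lt_eq {q : ℕ} (m : Fin q → (σ →₀ ℕ)) (i : Fin q) :
    {p | ∃ j < i, p = monomial (m j) (1 : K)} =
      (fun a => monomial a (1 : K)) '' (m '' {j | j < i}) := by
  ext p
  constructor
  · rintro ⟨j, hj, rfl⟩
    exact ⟨_, ⟨j, hj, rfl⟩, rfl⟩
  · rintro ⟨_, ⟨j, hj, rfl⟩, rfl⟩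
    exact ⟨j, hj, rfl⟩

/-- List the sets by increasing `f`. The exchange hypothesis says that any monomial in the colon at
`W` coming from an earlier `W'` is divisible by a variable `x_x`, `x ∈ W' \ W`, that already lies in
the colon because of `W''`. -/
theorem hasLinearQuotients_of_exchange [DecidableEq σ] {α : Type*} [LinearOrder α]
    {𝒲 : Set (Finset σ)} (hfin : 𝒲.Finite) {s : ℕ} (h𝒲 : ∀ W ∈ 𝒲, W.card = s)
    (f : Finset σ → α) (hf : Function.Injective f)
    (hex : ∀ W ∈ 𝒲, ∀ W' ∈ 𝒲, f W' < f W →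
      ∃ x ∈ W', x ∉ W ∧ ∃ W'' ∈ 𝒲, f W'' < f W ∧ W'' ⊆ insert x W) :
    HasLinearQuotients (Ideal.span ((fun a => monomial a (1 : K)) '' (sqfree '' 𝒲))) := by
  classical
  let S : Finset α := hfin.toFinset.image f
  let e := S.orderIsoOfFin rfl
  have hS : ∀ i, ∃ W ∈ 𝒲, f W = e i := fun i => by
    obtain ⟨W, hW, h⟩ := Finset.mem_image.1 (e i).2
    exact ⟨W, hfin.mem_toFinset.1 hW, h⟩
  choose w hw hwe using hS
  have hlt : ∀ i j, j < i ↔ f (w j) < f (w i) := fun i j => by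
    rw [hwe, hwe, Subtype.coe_lt_coe, e.lt_iff_lt]
  have hsurj : ∀ W ∈ 𝒲, ∃ i, w i = W := fun W hW => by
    refine ⟨e.symm ⟨f W, Finset.mem_image_of_mem f (hfin.mem_toFinset.2 hW)⟩, hf ?_⟩
    rw [hwe, OrderIso.apply_symm_apply]
  refine ⟨S.card, fun i => sqfree (w i), fun i j hij => ?_, ?_, fun i => ?_⟩
  · have h1 := congrArg f (sqfree_injective hij)
    rw [hwe, hwe] at h1
    exact e.injective (Subtype.ext h1)
  · rw [mingens_span_sqfree h𝒲]
    ext a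
    constructor
    · rintro ⟨i, rfl⟩
      exact ⟨w i, hw i, rfl⟩
    · rintro ⟨W, hW, rfl⟩
      obtain ⟨i, rfl⟩ := hsurj W hW
      exact ⟨i, rfl⟩
  · refine ⟨{t | ∃ j < i, w j ⊆ insert t (w i)}, ?_⟩
    ext p
    rw [setOf_exists_lt_eq, mem_span_monomial_colon, mem_ideal_span_X_image]
    refine forall₂_congr fun b _ => ?_
    constructor
    · rintro ⟨_, ⟨j, hj, rfl⟩, hle⟩
      obtain ⟨x, hx, hxi, W'', hW'', hlt'', hsub⟩ := hex (w i) (hw i) (w j) (hw j) ((hlt i j).1 hj)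
      obtain ⟨l, rfl⟩ := hsurj W'' hW''
      refine ⟨x, ⟨l, (hlt i l).2 hlt'', hsub⟩, ?_⟩
      have := sqfree_le_iff.1 hle x hx
      rwa [Finsupp.add_apply, sqfree_apply, if_neg hxi, add_zero] at this
    · rintro ⟨t, ⟨j, hj, hsub⟩, ht⟩
      refine ⟨_, ⟨j, hj, rfl⟩, sqfree_le_iff.2 fun v hv => ?_⟩
      change b v + sqfree (w i) v ≠ 0
      rcases Finset.mem_insert.1 (hsub hv) with rfl | h
      · omega
      · have := sqfree_apply_ne_zero.2 h
        omega

/-- Let `W` be the later and `W'` the earlier of the two. The colon at `W` contains the monomial of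
`W' \ W`, so linear quotients would yield `t ∈ W' \ W` and an earlier `V ⊆ W ∪ {t}`. Then `V` lies
in `W₁ ∪ W₂`, but it is not `W`, being earlier, and not `W'`, which has two elements outside `W`. -/
theorem not_hasLinearQuotients_of_pair [DecidableEq σ] {𝒲 : Set (Finset σ)} {s : ℕ}
    (h𝒲 : ∀ W ∈ 𝒲, W.card = s) {W₁ W₂ : Finset σ} (h₁ : W₁ ∈ 𝒲) (h₂ : W₂ ∈ 𝒲)
    (hcard : 2 ≤ (W₁ \ W₂).card)
    (h : ∀ W ∈ 𝒲, W ⊆ W₁ ∪ W₂ → W = W₁ ∨ W = W₂) :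
    ¬ HasLinearQuotients (Ideal.span ((fun a => monomial a (1 : K)) '' (sqfree '' 𝒲))) := by
  rintro ⟨q, m, hinj, hrange, hm⟩
  rw [mingens_span_sqfree h𝒲] at hrange
  have key : ∀ W W' : Finset σ, 2 ≤ (W' \ W).card → (∀ V ∈ 𝒲, V ⊆ W ∪ W' → V = W ∨ V = W') →
      ∀ i j, m i = sqfree W → m j = sqfree W' → j < i → False := by
    intro W W' hcard h i j hi hj hlt
    obtain ⟨T, hT⟩ := hm i
    have hmem : ∀ b, (∃ l < i, m l ≤ b + sqfree W) ↔ ∃ t ∈ T, b t ≠ 0 := by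
      intro b
      have := Ideal.ext_iff.1 hT (monomial b 1)
      rw [setOf_exists_lt_eq, mem_span_monomial_colon, mem_ideal_span_X_image] at this
      simpa [support_monomial, hi] using this
    obtain ⟨t, htT, ht⟩ := (hmem (sqfree (W' \ W))).1 ⟨j, hlt, by
      rw [hj, sqfree_add_sqfree Finset.sdiff_disjoint, Finset.sdiff_union_self_eq_union]
      exact sqfree_le_sqfree.2 Finset.subset_union_left⟩
    rw [sqfree_apply_ne_zero] at ht
    obtain ⟨htW', htW⟩ := Finset.mem_sdiff.1 ht
    obtain ⟨l, hli, hle⟩ := (hmem (sqfree {t})).2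
      ⟨t, htT, sqfree_apply_ne_zero.2 (Finset.mem_singleton_self t)⟩
    obtain ⟨V, hV, hVl⟩ : m l ∈ sqfree '' 𝒲 := hrange ▸ ⟨l, rfl⟩
    rw [← hVl, sqfree_add_sqfree (Finset.disjoint_singleton_left.2 htW),
      sqfree_le_sqfree] at hle
    have hV' : V = W ∨ V = W' := by
      refine h V hV (hle.trans ?_)
      rw [Finset.union_comm]
      refine Finset.union_subset_union_right ?_
      exact Finset.singleton_subset_iff.2 htW'
    rcases hV' with rfl | rfl
    · exact hli.ne (hinj (hVl.symm.trans hi.symm))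
    · have : V \ W ⊆ {t} := by
        intro y hy
        obtain ⟨hyV, hyW⟩ := Finset.mem_sdiff.1 hy
        exact (Finset.mem_union.1 (hle hyV)).resolve_right hyW
      have := Finset.card_le_card this
      rw [Finset.card_singleton] at this
      omega
  have hmem : ∀ W ∈ 𝒲, ∃ i, m i = sqfree W := fun W hW => by
    have : sqfree W ∈ Set.range m := hrange ▸ ⟨W, hW, rfl⟩
    exact this
  obtain ⟨i₁, hi₁⟩ := hmem W₁ h₁
  obtain ⟨i₂, hi₂⟩ := hmem W₂ h₂
  rcases lt_trichotomy i₁ i₂ with hlt | heq | hlt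
  · refine key W₂ W₁ hcard (fun V hV hsub => ?_) i₂ i₁ hi₂ hi₁ hlt
    rw [Finset.union_comm] at hsub
    exact (h V hV hsub).symm
  · rw [heq, hi₂] at hi₁
    rw [sqfree_injective hi₁] at hcard
    simp at hcard
  · refine key W₁ W₂ ?_ h i₁ i₂ hi₁ hi₂ hlt
    have h3 := Finset.card_sdiff_add_card_inter W₁ W₂
    have h4 := Finset.card_sdiff_add_card_inter W₂ W₁
    rw [Finset.inter_comm, h𝒲 _ h₂] at h4
    rw [h𝒲 _ h₁] at h3
    omega

theorem span_sqfree_ne_bot {𝒲 : Set (Finset σ)} (h : 𝒲.Nonempty) :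
    Ideal.span ((fun a => monomial a (1 : K)) '' (sqfree '' 𝒲)) ≠ ⊥ := by
  obtain ⟨W, hW⟩ := h
  intro hbot
  have : monomial (sqfree W) (1 : K) ∈ (⊥ : Ideal (MvPolynomial σ K)) := by
    rw [← hbot]
    exact Ideal.subset_span ⟨_, ⟨W, hW, rfl⟩, rfl⟩
  rw [Ideal.mem_bot, monomial_eq_zero] at this
  exact one_ne_zero this

/-- The exchange property for the order in which `W'` precedes `W` if the least element of their
symmetric difference lies in `W'`. -/
theorem hasLinearQuotients_of_lex_exchange [LinearOrder σ] [Fintype σ]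
    {𝒲 : Set (Finset σ)} {s : ℕ} (h𝒲 : ∀ W ∈ 𝒲, W.card = s)
    (hex : ∀ W ∈ 𝒲, ∀ W' ∈ 𝒲, ∀ x ∈ W', x ∉ W → (∀ y < x, y ∈ W' ↔ y ∈ W) →
      ∃ x' ∈ W', x' ∉ W ∧ ∃ w ∈ W, x' < w ∧ insert x' (W.erase w) ∈ 𝒲) :
    HasLinearQuotients (Ideal.span ((fun a => monomial a (1 : K)) '' (sqfree '' 𝒲))) := by
  classical
  -- Membership is encoded by `0`, so that the set containing the least differing element comes
  -- first.
  let f : Finset σ → Lex (σ → ℕ) := fun W => toLex fun v => if v ∈ W then 0 else 1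
  have hlt : ∀ W' W, f W' < f W ↔ ∃ x, (∀ y < x, y ∈ W' ↔ y ∈ W) ∧ x ∈ W' ∧ x ∉ W := by
    intro W' W
    change (∃ x, (∀ y < x, (if y ∈ W' then 0 else 1) = (if y ∈ W then 0 else 1)) ∧
      (if x ∈ W' then 0 else 1) < (if x ∈ W then 0 else 1)) ↔ _
    refine exists_congr fun x => and_congr (forall₂_congr fun y _ => ?_) ?_
    · by_cases h1 : y ∈ W' <;> by_cases h2 : y ∈ W <;> simp [h1, h2]
    · by_cases h1 : x ∈ W' <;> by_cases h2 : x ∈ W <;> simp [h1, h2]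
  refine hasLinearQuotients_of_exchange (Set.toFinite 𝒲) h𝒲 f (fun W W' h => ?_) ?_
  · ext v
    have := congrFun (congrArg ofLex h) v
    change (if v ∈ W then 0 else 1) = (if v ∈ W' then 0 else 1) at this
    by_cases h1 : v ∈ W <;> by_cases h2 : v ∈ W' <;> simp_all
  · intro W hW W' hW' h
    obtain ⟨x, hagree, hxW', hxW⟩ := (hlt W' W).1 h
    obtain ⟨x', hx', hx'W, w, hw, hlt', hmem⟩ := hex W hW W' hW' x hxW' hxW hagree
    refine ⟨x', hx', hx'W, _, hmem, (hlt _ _).2 ⟨x', fun y hy => ?_, by simp, hx'W⟩,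
      Finset.insert_subset_insert _ (Finset.erase_subset _ _)⟩
    rw [Finset.mem_insert, Finset.mem_erase]
    have h1 : y ≠ x' := hy.ne
    have h2 : y ≠ w := (hy.trans hlt').ne
    simp [h1, h2]

end LinearQuotients

/-! ### Disconnected induced subgraphs of `ACH n r` -/

section ACH

variable {n r : ℕ}

/-- Values are labels minus one. The path runs through `r, …, r + n - 5`, then `d = r + n - 3`, and
ends at `e = r + n - 4`: its last two vertices appear in reversed order, hence the separate clauses
for `r + n - 5` and `r + n - 4`. -/
theorem ACH_adj_iff (hn : 6 ≤ n) {v w : Fin (r + n)} (h : v < w) :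
    (ACH n r).Adj v w ↔
      ((v : ℕ) < r ∧ ((w : ℕ) < r ∨ r + n ≤ w + 3)) ∨
      (r ≤ (v : ℕ) ∧ (v : ℕ) + 5 < r + n ∧ (w : ℕ) = v + 1) ∨
      ((v : ℕ) + 5 = r + n ∧ (w : ℕ) + 3 = r + n) ∨
      ((v : ℕ) + 4 = r + n ∧ (w : ℕ) + 3 = r + n) ∨
      (r < (v : ℕ) ∧ (w : ℕ) + 2 = r + n) ∨
      (r ≤ (v : ℕ) ∧ (v : ℕ) + 4 ≠ r + n ∧ (w : ℕ) + 1 = r + n) := by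
  have hv := v.2
  have hw := w.2
  rw [Fin.lt_def] at h
  have hne : v ≠ w := fun h' => by rw [h'] at h; exact lt_irrefl _ h
  rw [ACH, SimpleGraph.fromRel_adj]
  generalize hV : (v : ℕ) = a at *
  generalize hW : (w : ℕ) = b at *
  simp only [ne_eq, hne, not_false_eq_true, true_and, ACHRel, HRel]
  constructor
  · rintro ((((⟨i, hi⟩ | hi | hi | ⟨hi, j, hj⟩ | ⟨hi, j, hj⟩) | hi | hi)) |
      ((⟨i, hi⟩ | hi | hi | ⟨hi, j, hj⟩ | ⟨hi, j, hj⟩) | hi | hi)) <;> omega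
  · rintro (⟨h1, h2 | h2⟩ | h1 | h1 | h1 | h1 | h1)
    · exact Or.inl (Or.inr (Or.inl (by omega)))
    · exact Or.inl (Or.inr (Or.inr (by omega)))
    · exact Or.inl (Or.inl (Or.inl ⟨a + 1 - r, by omega⟩))
    · exact Or.inl (Or.inl (Or.inr (Or.inl (by omega))))
    · exact Or.inr (Or.inl (Or.inr (Or.inr (Or.inl (by omega)))))
    · exact Or.inr (Or.inl (Or.inr (Or.inr (Or.inr (Or.inl ⟨by omega, a + 1 - r, by omega⟩)))))
    · exact Or.inr (Or.inl (Or.inr (Or.inr (Or.inr (Or.inr ⟨by omega, a + 1 - r, by omega⟩)))))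

/-- The larger neighbours are: for a clique vertex, later clique vertices and `d, b, a`; for `p`,
`q` and `a`; for a later path vertex before `e`, its successor, `b` and `a`; for `e`, `d` and `b`;
for `d`, `b` and `a`. Each list is a clique. -/
theorem ACH_adj_of_adj_of_adj (hn : 6 ≤ n) (w u v : Fin (r + n)) (hwu : w < u) (hwv : w < v)
    (huv : u ≠ v) (hu : (ACH n r).Adj w u) (hv : (ACH n r).Adj w v) : (ACH n r).Adj u v := by
  rw [ACH_adj_iff hn hwu] at hu
  rw [ACH_adj_iff hn hwv] at hv
  have h1 := u.2
  have h2 := v.2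
  rcases lt_or_gt_of_ne huv with h | h
  · rw [ACH_adj_iff hn h]
    rw [Fin.lt_def] at *
    omega
  · rw [SimpleGraph.adj_comm, ACH_adj_iff hn h]
    rw [Fin.lt_def] at *
    omega

/-- No element of `W` has value `c`. -/
abbrev Omits (W : Finset (Fin (r + n))) (c : ℕ) : Prop := ∀ u ∈ W, (u : ℕ) ≠ c

/-- The cases follow the position of the witness: in the clique (then `d, b, a` are absent), on the
path before `e` (then its successor and `a` are absent, and `b` too unless the witness is `p`), or
at `e` (then `a` is present and `d, b` are absent). -/
theorem ACH_splits_cases (hn : 6 ≤ n) {W : Finset (Fin (r + n))} (h : (ACH n r).Splits W) :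
    ((∃ v ∈ W, (v : ℕ) < r) ∧ (∃ u ∈ W, r ≤ (u : ℕ)) ∧ ∀ u ∈ W, (u : ℕ) + 3 < r + n) ∨
    (∃ v ∈ W, r ≤ (v : ℕ) ∧ (v : ℕ) + 5 ≤ r + n ∧ (∃ u ∈ W, v < u) ∧ ∀ u ∈ W,
      (u : ℕ) + 1 ≠ r + n ∧ ((v : ℕ) + 5 < r + n → (u : ℕ) ≠ v + 1) ∧
      ((v : ℕ) + 5 = r + n → (u : ℕ) + 3 ≠ r + n) ∧ (r < (v : ℕ) → (u : ℕ) + 2 ≠ r + n)) ∨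
    ((∃ v ∈ W, (v : ℕ) + 4 = r + n) ∧ (∃ u ∈ W, (u : ℕ) + 1 = r + n) ∧
      ∀ u ∈ W, (u : ℕ) + 3 ≠ r + n ∧ (u : ℕ) + 2 ≠ r + n) := by
  obtain ⟨v, hv, ⟨u₀, hu₀, hvu₀⟩, hW⟩ := h
  have hv2 := v.2
  have hu2 := u₀.2
  have hW' : ∀ u ∈ W, v < u → _ := fun u hu hvu => (not_congr (ACH_adj_iff hn hvu)).1 (hW u hu hvu)
  have h0 := hW' u₀ hu₀ hvu₀
  have hvu₀' := Fin.lt_def.1 hvu₀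
  by_cases h1 : (v : ℕ) < r
  · refine Or.inl ⟨⟨v, hv, h1⟩, ⟨u₀, hu₀, by omega⟩, fun u hu => ?_⟩
    rcases le_or_gt u v with h | h
    · rw [Fin.le_def] at h
      omega
    · have := hW' u hu h
      omega
  by_cases h2 : (v : ℕ) + 5 ≤ r + n
  · refine Or.inr (Or.inl ⟨v, hv, by omega, h2, ⟨u₀, hu₀, hvu₀⟩, fun u hu => ?_⟩)
    rcases le_or_gt u v with h | h
    · rw [Fin.le_def] at h
      omega
    · have := hW' u hu h
      omega
  · refine Or.inr (Or.inr ⟨⟨v, hv, by omega⟩, ⟨u₀, hu₀, by omega⟩, fun u hu => ?_⟩)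
    rcases le_or_gt u v with h | h
    · rw [Fin.le_def] at h
      omega
    · have := hW' u hu h
      omega

theorem ACH_splits_of_clique_part (hn : 6 ≤ n) {W : Finset (Fin (r + n))}
    (h1 : ∃ v ∈ W, (v : ℕ) < r) (h2 : ∃ u ∈ W, r ≤ (u : ℕ))
    (h3 : ∀ u ∈ W, (u : ℕ) + 3 < r + n) : (ACH n r).Splits W := by
  classical
  obtain ⟨v₀, hv₀, hv₀r⟩ := h1
  obtain ⟨u, hu, hur⟩ := h2
  obtain ⟨v, hv, hmax⟩ := (W.filter fun v : Fin (r + n) => (v : ℕ) < r).exists_max_image id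
    ⟨v₀, Finset.mem_filter.2 ⟨hv₀, hv₀r⟩⟩
  obtain ⟨hvW, hvr⟩ := Finset.mem_filter.1 hv
  refine ⟨v, hvW, ⟨u, hu, Fin.lt_def.2 (by omega)⟩, fun w hw hvw => ?_⟩
  rw [ACH_adj_iff hn hvw]
  have h4 := h3 w hw
  have h5 : ¬ (w : ℕ) < r := fun hwr =>
    absurd (hmax w (Finset.mem_filter.2 ⟨hw, hwr⟩)) hvw.not_ge
  omega

theorem ACH_splits_of_path_gap (hn : 6 ≤ n) {W : Finset (Fin (r + n))} {v u : Fin (r + n)}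
    (hv : v ∈ W) (hu : u ∈ W) (hvu : v < u) (h1 : r ≤ (v : ℕ)) (h2 : (v : ℕ) + 5 ≤ r + n)
    (h3 : ∀ u ∈ W, (u : ℕ) + 1 ≠ r + n ∧ ((v : ℕ) + 5 < r + n → (u : ℕ) ≠ v + 1) ∧
      ((v : ℕ) + 5 = r + n → (u : ℕ) + 3 ≠ r + n) ∧ (r < (v : ℕ) → (u : ℕ) + 2 ≠ r + n)) :
    (ACH n r).Splits W := by
  refine ⟨v, hv, ⟨u, hu, hvu⟩, fun w hw hvw => ?_⟩
  rw [ACH_adj_iff hn hvw]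
  have := h3 w hw
  rw [Fin.lt_def] at *
  omega

theorem ACH_splits_of_end (hn : 6 ≤ n) {W : Finset (Fin (r + n))} {v u : Fin (r + n)}
    (hv : v ∈ W) (hu : u ∈ W) (h1 : (v : ℕ) + 4 = r + n) (h2 : (u : ℕ) + 1 = r + n)
    (h3 : ∀ u ∈ W, (u : ℕ) + 3 ≠ r + n ∧ (u : ℕ) + 2 ≠ r + n) : (ACH n r).Splits W := by
  refine ⟨v, hv, ⟨u, hu, Fin.lt_def.2 (by omega)⟩, fun w hw hvw => ?_⟩
  rw [ACH_adj_iff hn hvw]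
  have := h3 w hw
  rw [Fin.lt_def] at *
  omega

/-- The only neighbours of `e` are `d` and `b`, so `e` is isolated in `W`. Without clique vertices,
the formal witness is the largest element below `e`. -/
theorem ACH_splits_of_leaf (hn : 6 ≤ n) {W : Finset (Fin (r + n))} {e v : Fin (r + n)}
    (he : e ∈ W) (he4 : (e : ℕ) + 4 = r + n) (hv : v ∈ W) (hve : v ≠ e)
    (h : ∀ u ∈ W, (u : ℕ) + 3 < r + n) : (ACH n r).Splits W := by
  classical
  by_cases h1 : ∃ v ∈ W, (v : ℕ) < r
  · exact ACH_splits_of_clique_part hn h1 ⟨e, he, by omega⟩ h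
  push Not at h1
  have hvlt : v < e := by
    have := h v hv
    rw [Fin.lt_def]
    rw [Ne, Fin.ext_iff] at hve
    omega
  obtain ⟨m, hm, hmax⟩ := (W.filter fun v => v < e).exists_max_image id
    ⟨v, Finset.mem_filter.2 ⟨hv, hvlt⟩⟩
  obtain ⟨hmW, hme⟩ := Finset.mem_filter.1 hm
  have hme' := Fin.lt_def.1 hme
  refine ACH_splits_of_path_gap hn hmW he hme (h1 m hmW) (by omega) fun u hu => ?_
  have h3 := h u hu
  have h4 : (u : ℕ) < e → (u : ℕ) ≤ m := fun hue =>
    Fin.le_def.1 (hmax u (Finset.mem_filter.2 ⟨hu, Fin.lt_def.2 hue⟩))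
  omega

/-- Once `b` and `a` are gone, an omitted path vertex `g` cuts the path; the witness is the largest
element below `g`. -/
theorem ACH_splits_of_omits (hn : 6 ≤ n) {W : Finset (Fin (r + n))} {v u : Fin (r + n)} {g : ℕ}
    (hv : v ∈ W) (hu : u ∈ W) (hrv : r ≤ (v : ℕ)) (hvg : (v : ℕ) < g) (hgu : g < (u : ℕ))
    (hg : g + 5 ≤ r + n) (hgW : Omits W g) (h : ∀ u ∈ W, (u : ℕ) + 2 < r + n) :
    (ACH n r).Splits W := by
  classical
  obtain ⟨m, hm, hmax⟩ := (W.filter fun v : Fin (r + n) => (v : ℕ) < g).exists_max_image id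
    ⟨v, Finset.mem_filter.2 ⟨hv, hvg⟩⟩
  obtain ⟨hmW, hmg⟩ := Finset.mem_filter.1 hm
  have hvm := Fin.le_def.1 (hmax v (Finset.mem_filter.2 ⟨hv, hvg⟩))
  simp only [id] at hvm
  refine ACH_splits_of_path_gap hn hmW hu (Fin.lt_def.2 (by omega)) (by omega) (by omega)
    fun w hw => ?_
  have h3 := h w hw
  have h4 := hgW w hw
  have h5 : (w : ℕ) < g → (w : ℕ) ≤ m := fun hwg =>
    Fin.le_def.1 (hmax w (Finset.mem_filter.2 ⟨hw, hwg⟩))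
  omega

theorem exists_gt_of_agree {σ : Type*} [LinearOrder σ] {W W' : Finset σ} (hcard : W.card = W'.card)
    {x : σ} (hx' : x ∈ W') (hx : x ∉ W) (hagree : ∀ y < x, y ∈ W' ↔ y ∈ W) :
    ∃ w ∈ W, x < w := by
  by_contra! h
  have hsub : W ⊂ W' := by
    refine Finset.ssubset_iff_subset_ne.2 ⟨fun y hy => ?_, fun he => hx (he ▸ hx')⟩
    exact (hagree y (lt_of_le_of_ne (h y hy) fun he => hx (he ▸ hy))).2 hy
  exact (Finset.card_lt_card hsub).ne hcard

theorem insert_erase_eq_of_unique_gt {σ : Type*} [LinearOrder σ] {W W' : Finset σ}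
    (hcard : W.card = W'.card) {x w : σ} (hx' : x ∈ W') (hx : x ∉ W)
    (hagree : ∀ y < x, y ∈ W' ↔ y ∈ W) (hw : w ∈ W) (h : ∀ y ∈ W, x < y → y = w) :
    insert x (W.erase w) = W' := by
  refine Finset.eq_of_subset_of_card_le (fun y hy => ?_) ?_
  · rcases Finset.mem_insert.1 hy with rfl | hy
    · exact hx'
    · obtain ⟨hyw, hyW⟩ := Finset.mem_erase.1 hy
      rcases lt_trichotomy y x with h1 | rfl | h1
      · exact (hagree y h1).2 hyW
      · exact hx'
      · exact absurd (h y hyW h1) hyw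
  · rw [Finset.card_insert_of_notMem (fun h' => hx (Finset.mem_of_mem_erase h')),
      Finset.card_erase_add_one hw, hcard]

theorem ACH_exchange_of_last_mem (hn : 6 ≤ n) {W : Finset (Fin (r + n))}
    (hW : (ACH n r).Splits W) {x a : Fin (r + n)} (hx : x ∉ W) (ha : a ∈ W)
    (ha1 : (a : ℕ) + 1 = r + n) (hx3 : (x : ℕ) + 3 < r + n) :
    (ACH n r).Splits (insert x (W.erase a)) := by
  obtain h | ⟨v, -, -, -, -, h⟩ | ⟨⟨e, he, he4⟩, -, h⟩ := ACH_splits_cases hn hW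
  · exact absurd (h.2.2 a ha) (by omega)
  · exact absurd ha1 (h a ha).1
  · have hea : e ≠ a := fun h => by rw [h] at he4; omega
    refine ACH_splits_of_leaf hn (e := e) (v := x) ?_ he4 (Finset.mem_insert_self _ _)
      (fun h => hx (h ▸ he)) fun u hu => ?_
    · exact Finset.mem_insert_of_mem (Finset.mem_erase.2 ⟨hea, he⟩)
    · rcases Finset.mem_insert.1 hu with rfl | hu
      · exact hx3
      · obtain ⟨hua, huW⟩ := Finset.mem_erase.1 hu
        have := h u huW
        have := u.2
        rw [Ne, Fin.ext_iff] at hua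
        omega

/-- The neighbours of `p` are `q` and `a`, both absent, so `p` is isolated in the new set. If
nothing exceeds `p`, it is the maximum, and the witness has to be taken in the clique. -/
theorem ACH_exchange_of_penultimate_mem (hn : 6 ≤ n) {W : Finset (Fin (r + n))}
    {x b p : Fin (r + n)} (hp : p ∈ W) (hpr : (p : ℕ) = r) (hp' : Omits W (r + 1))
    (ha : Omits W (r + n - 1))
    (hx : x ∉ W) (hb : (b : ℕ) + 2 = r + n) (hxb : x < b) (hxr : (x : ℕ) ≠ r + 1) :
    (ACH n r).Splits (insert x (W.erase b)) := by
  have hpb : p ≠ b := fun h => by rw [h] at hpr; omega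
  have hpV : p ∈ insert x (W.erase b) :=
    Finset.mem_insert_of_mem (Finset.mem_erase.2 ⟨hpb, hp⟩)
  have hV : ∀ u ∈ insert x (W.erase b), (u : ℕ) ≠ r + 1 ∧ (u : ℕ) + 2 < r + n := by
    intro u hu
    rcases Finset.mem_insert.1 hu with rfl | hu
    · rw [Fin.lt_def] at hxb
      exact ⟨hxr, by omega⟩
    · obtain ⟨hub, huW⟩ := Finset.mem_erase.1 hu
      refine ⟨hp' u huW, ?_⟩
      have := ha u huW
      have := u.2
      rw [Ne, Fin.ext_iff] at hub
      omega
  by_cases h : ∃ u ∈ insert x (W.erase b), r < (u : ℕ)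
  · obtain ⟨u, hu, hru⟩ := h
    refine ACH_splits_of_path_gap hn hpV hu (Fin.lt_def.2 (by omega)) (by omega) (by omega)
      fun w hw => ?_
    have := hV w hw
    omega
  · push Not at h
    refine ACH_splits_of_clique_part hn ⟨x, Finset.mem_insert_self _ _, ?_⟩ ⟨p, hpV, by omega⟩
      fun u hu => ?_
    · have h1 := h x (Finset.mem_insert_self _ _)
      have h2 : x ≠ p := fun h => hx (h ▸ hp)
      rw [Ne, Fin.ext_iff] at h2
      omega
    · have := h u hu
      omega

theorem exists_omitted (hn : 6 ≤ n) {V : Finset (Fin (r + n))} (hcard : V.card + 3 ≤ n) :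
    ∃ g, r ≤ g ∧ g + 2 < r + n ∧ Omits V g := by
  by_contra! h
  have hsub : Finset.Ico r (r + n - 2) ⊆ V.map Fin.valEmbedding := by
    intro g hg
    rw [Finset.mem_Ico] at hg
    have := h g hg.1 (by omega)
    simp only [Omits, not_forall, not_not] at this
    obtain ⟨u, hu, rfl⟩ := this
    exact Finset.mem_map.2 ⟨u, hu, rfl⟩
  have := Finset.card_le_card hsub
  rw [Finset.card_map, Nat.card_Ico] at this
  omega

/-- The element removed is `a` if `a ∈ W`, leaving `e` isolated, and otherwise `b` if `b ∈ W`,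
leaving `p` isolated as long as `q` is not inserted. If both are absent, the inserted `x` becomes a
witness, either as a clique vertex or by a gap after it on the path. When `x` is the only place
where `W` can change, the result is `W'` itself. -/
theorem ACH_exchange (hn : 6 ≤ n) {W W' : Finset (Fin (r + n))} (hW : (ACH n r).Splits W)
    (hW' : (ACH n r).Splits W') (hcard : W.card = W'.card) (hs : W.card + 3 ≤ n)
    {x : Fin (r + n)} (hx' : x ∈ W') (hx : x ∉ W) (hagree : ∀ y < x, y ∈ W' ↔ y ∈ W) :
    ∃ x' ∈ W', x' ∉ W ∧ ∃ w ∈ W, x' < w ∧ (ACH n r).Splits (insert x' (W.erase w)) := by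
  classical
  obtain ⟨w₀, hw₀, hxw₀⟩ := exists_gt_of_agree hcard hx' hx hagree
  by_cases huniq : ∀ y ∈ W, x < y → y = w₀
  · refine ⟨x, hx', hx, w₀, hw₀, hxw₀, ?_⟩
    rwa [insert_erase_eq_of_unique_gt hcard hx' hx hagree hw₀ huniq]
  have hother : ∀ w, ∃ y ∈ W, x < y ∧ y ≠ w := by
    intro w
    push Not at huniq
    obtain ⟨y, hy, hxy, hyw⟩ := huniq
    by_cases hw : w = w₀
    · exact ⟨y, hy, hxy, hw ▸ hyw⟩
    · exact ⟨w₀, hw₀, hxw₀, Ne.symm hw⟩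
  have hmemV : ∀ {x w u}, u ∈ insert x (W.erase w) ↔ u = x ∨ (u ≠ w ∧ u ∈ W) := by
    intro x w u
    rw [Finset.mem_insert, Finset.mem_erase]
  by_cases ha : ∃ a ∈ W, (a : ℕ) + 1 = r + n
  · obtain ⟨a, ha, ha1⟩ := ha
    obtain ⟨y, hy, hxy, hya⟩ := hother a
    have hyn := y.2
    have hyne : (y : ℕ) ≠ a := fun h => hya (Fin.ext h)
    rw [Fin.lt_def] at hxy
    have hy3 : (y : ℕ) + 3 ≠ r + n ∧ (y : ℕ) + 2 ≠ r + n := by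
      obtain h | ⟨v, -, -, -, -, h⟩ | ⟨-, -, h⟩ := ACH_splits_cases hn hW
      · exact absurd (h.2.2 a ha) (by omega)
      · exact absurd ha1 (h a ha).1
      · exact h y hy
    refine ⟨x, hx', hx, a, ha, Fin.lt_def.2 (by omega), ?_⟩
    exact ACH_exchange_of_last_mem hn hW hx ha ha1 (by omega)
  have ha' : Omits W (r + n - 1) := fun u hu h => ha ⟨u, hu, by omega⟩
  by_cases hb : ∃ b ∈ W, (b : ℕ) + 2 = r + n
  · obtain ⟨b, hb, hb2⟩ := hb
    have hpen : ∀ V, (ACH n r).Splits V → b ∈ V → Omits V (r + n - 1) →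
        (∃ p ∈ V, (p : ℕ) = r) ∧ Omits V (r + 1) := by
      intro V hV hbV haV
      obtain h | ⟨v, hv, h1, h2, -, h⟩ | ⟨-, ⟨a, haa, h1⟩, h⟩ := ACH_splits_cases hn hV
      · exact absurd (h.2.2 b hbV) (by omega)
      · have h3 := h b hbV
        refine ⟨⟨v, hv, by omega⟩, fun u hu => ?_⟩
        have := h u hu
        omega
      · exact absurd (haV a haa) (by omega)
    obtain ⟨⟨p, hp, hpr⟩, hp1⟩ := hpen W hW hb ha'
    have hxb : x < b := by
      have h1 := ha' w₀ hw₀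
      have h2 := w₀.2
      rw [Fin.lt_def] at hxw₀ ⊢
      have h3 : x ≠ b := fun h => hx (h ▸ hb)
      rw [Ne, Fin.ext_iff] at h3
      omega
    by_cases hxr : (x : ℕ) ≠ r + 1
    · exact ⟨x, hx', hx, b, hb, hxb,
        ACH_exchange_of_penultimate_mem hn hp hpr hp1 ha' hx hb2 hxb hxr⟩
    rw [not_not] at hxr
    -- Inserting `x = q` would give `p` a neighbour, so another element of `W' \ W` is preferred. If
    -- there is none, `W' \ W ⊆ {q, a}`.
    by_cases hz : ∃ z ∈ W', z ∉ W ∧ (z : ℕ) ≠ r + 1 ∧ (z : ℕ) + 1 ≠ r + n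
    · obtain ⟨z, hz', hz, hzr, hzn⟩ := hz
      have hzb : z < b := by
        have h2 := z.2
        have h3 : z ≠ b := fun h => hz (h ▸ hb)
        rw [Ne, Fin.ext_iff] at h3
        rw [Fin.lt_def]
        omega
      exact ⟨z, hz', hz, b, hb, hzb,
        ACH_exchange_of_penultimate_mem hn hp hpr hp1 ha' hz hb2 hzb hzr⟩
    push Not at hz
    refine ⟨x, hx', hx, b, hb, hxb, ?_⟩
    have hcardV : (insert x (W.erase b)).card = W.card := by
      rw [Finset.card_insert_of_notMem (fun h => hx (Finset.mem_of_mem_erase h)),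
        Finset.card_erase_add_one hb]
    by_cases haW' : ∃ a ∈ W', (a : ℕ) + 1 = r + n
    · obtain ⟨a, haW', ha1⟩ := haW'
      obtain ⟨e, he, he4⟩ : ∃ e ∈ W', (e : ℕ) + 4 = r + n := by
        obtain h | ⟨v, -, -, -, -, h⟩ | ⟨h, -, -⟩ := ACH_splits_cases hn hW'
        · exact absurd (h.2.2 a haW') (by omega)
        · exact absurd ha1 (h a haW').1
        · exact h
      have heW : e ∈ W := by
        by_contra heW
        have := hz e he heW (by omega)
        omega
      have heV : e ∈ insert x (W.erase b) :=
        hmemV.2 (Or.inr ⟨fun h => by rw [h] at he4; omega, heW⟩)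
      have hpV : p ∈ insert x (W.erase b) :=
        hmemV.2 (Or.inr ⟨fun h => by rw [h] at hpr; omega, hp⟩)
      have hV2 : ∀ u ∈ insert x (W.erase b), (u : ℕ) + 2 < r + n := by
        intro u hu
        rcases hmemV.1 hu with rfl | ⟨hub, huW⟩
        · omega
        · have := ha' u huW
          have := u.2
          rw [Ne, Fin.ext_iff] at hub
          omega
      by_cases h3 : ∃ u ∈ insert x (W.erase b), (u : ℕ) + 3 = r + n
      · obtain ⟨u, hu, hu3⟩ := h3
        -- The bound on the size enters here: the path has `n - 2` vertices, so one of them is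
        -- missing. As `p`, `e`, `d` are present, the gap lies strictly between `p` and `e`.
        obtain ⟨g, hg1, hg2, hg⟩ := exists_omitted hn (V := insert x (W.erase b)) (by omega)
        have h4 := hg p hpV
        have h5 := hg e heV
        have h6 := hg u hu
        exact ACH_splits_of_omits hn (g := g) hpV heV (by omega) (by omega) (by omega) (by omega)
          hg hV2
      · refine ACH_splits_of_leaf hn heV he4 hpV (fun h => by rw [h] at hpr; omega) fun u hu => ?_
        have h4 := hV2 u hu
        have h5 : (u : ℕ) + 3 ≠ r + n := fun h => h3 ⟨u, hu, h⟩
        omega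
    · have haW'' : Omits W' (r + n - 1) := fun u hu h => haW' ⟨u, hu, by omega⟩
      have hbW' : b ∉ W' := fun h => (hpen W' hW' h haW'').2 x hx' hxr
      have hsub : W' ⊆ insert x (W.erase b) := by
        intro z hzW'
        by_cases hzW : z ∈ W
        · exact hmemV.2 (Or.inr ⟨fun h => hbW' (h ▸ hzW'), hzW⟩)
        · refine hmemV.2 (Or.inl (Fin.ext ?_))
          by_contra hne
          exact haW' ⟨z, hzW', hz z hzW' hzW (by omega)⟩
      rw [← Finset.eq_of_subset_of_card_le hsub (by omega)]
      exact hW'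
  have hb' : Omits W (r + n - 2) := fun u hu h => hb ⟨u, hu, by omega⟩
  have hlt : ∀ u ∈ W, (u : ℕ) + 2 < r + n := fun u hu => by
    have h1 := ha' u hu
    have h2 := hb' u hu
    have h3 := u.2
    omega
  by_cases hxr : (x : ℕ) < r
  · obtain ⟨u₀, hu₀, hu₀r, hu₀3⟩ : ∃ u ∈ W, r ≤ (u : ℕ) ∧ (u : ℕ) + 3 < r + n := by
      obtain ⟨-, ⟨u, hu, h1⟩, h⟩ | ⟨v, hv, h1, h2, -, h⟩ | ⟨-, ⟨a, haa, h1⟩, h⟩ :=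
        ACH_splits_cases hn hW
      · exact ⟨u, hu, h1, h u hu⟩
      · exact ⟨v, hv, h1, by omega⟩
      · exact absurd (ha' a haa) (by omega)
    have key : ∀ w ∈ W, x < w → w ≠ u₀ → (∀ u ∈ W, u ≠ w → (u : ℕ) + 3 ≠ r + n) →
        (ACH n r).Splits (insert x (W.erase w)) := by
      intro w hw hxw hwu hall
      refine ACH_splits_of_clique_part hn ⟨x, Finset.mem_insert_self _ _, hxr⟩
        ⟨u₀, hmemV.2 (Or.inr ⟨hwu.symm, hu₀⟩), hu₀r⟩ fun u hu => ?_
      rcases hmemV.1 hu with rfl | ⟨huw, huW⟩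
      · omega
      · have h1 := hall u huW huw
        have h2 := hlt u huW
        omega
    by_cases h3 : ∃ u ∈ W, (u : ℕ) + 3 = r + n
    · obtain ⟨u, hu, hu3⟩ := h3
      have hxu : x < u := Fin.lt_def.2 (by omega)
      refine ⟨x, hx', hx, u, hu, hxu, key u hu hxu (fun h => by rw [h] at hu3; omega)
        fun w hw hwu hw3 => hwu (Fin.ext (by omega))⟩
    · obtain ⟨w, hw, hxw, hwu⟩ := hother u₀
      exact ⟨x, hx', hx, w, hw, hxw, key w hw hxw hwu fun u hu _ h => h3 ⟨u, hu, h⟩⟩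
  -- At least two elements of `W` exceed `x`, and none of them exceeds `d = r + n - 3`.
  · have hx5 : (x : ℕ) + 5 ≤ r + n := by
      obtain ⟨y, hy, hxy, hyw⟩ := hother w₀
      have h1 := hlt y hy
      have h2 := hlt w₀ hw₀
      rw [Fin.lt_def] at hxy hxw₀
      rw [Ne, Fin.ext_iff] at hyw
      omega
    have key : ∀ w ∈ W, x < w →
        (∀ u ∈ W, u ≠ w → ((x : ℕ) + 5 < r + n → (u : ℕ) ≠ x + 1) ∧
          ((x : ℕ) + 5 = r + n → (u : ℕ) + 3 ≠ r + n)) →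
        (ACH n r).Splits (insert x (W.erase w)) := by
      intro w hw hxw hall
      obtain ⟨y, hy, hxy, hyw⟩ := hother w
      refine ACH_splits_of_path_gap hn (Finset.mem_insert_self _ _)
        (hmemV.2 (Or.inr ⟨hyw, hy⟩)) hxy (by omega) hx5 fun u hu => ?_
      rcases hmemV.1 hu with rfl | ⟨huw, huW⟩
      · omega
      · have h1 := hall u huW huw
        have h2 := hlt u huW
        omega
    by_cases hnext : ∃ u ∈ W, ((x : ℕ) + 5 < r + n ∧ (u : ℕ) = x + 1) ∨
        ((x : ℕ) + 5 = r + n ∧ (u : ℕ) + 3 = r + n)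
    · obtain ⟨w, hw, hwx⟩ := hnext
      have hxw : x < w := Fin.lt_def.2 (by omega)
      refine ⟨x, hx', hx, w, hw, hxw, key w hw hxw fun u hu huw => ?_⟩
      rw [Ne, Fin.ext_iff] at huw
      omega
    · push Not at hnext
      exact ⟨x, hx', hx, w₀, hw₀, hxw₀, key w₀ hw₀ hxw₀ fun u hu _ => hnext u hu⟩

theorem card_add_two_le_of_notMem {N : ℕ} {W : Finset (Fin N)} {a b : Fin N} (hab : a ≠ b)
    (ha : a ∉ W) (hb : b ∉ W) : W.card + 2 ≤ N := by
  have h1 : (insert a (insert b W)).card = W.card + 2 := by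
    rw [Finset.card_insert_of_notMem, Finset.card_insert_of_notMem hb]
    simp [hab, ha]
  have h2 := Finset.card_le_univ (insert a (insert b W))
  rwa [h1, Fintype.card_fin] at h2

/-- Each kind of splitting set misses two definite vertices: `a` and `b`, or `a` and the successor
of the witness, or `b` and `d`. -/
theorem ACH_card_add_two_le (hn : 6 ≤ n) {W : Finset (Fin (r + n))} (hW : (ACH n r).Splits W) :
    W.card + 2 ≤ r + n := by
  have key : ∀ a b : ℕ, a < r + n → b < r + n → a ≠ b → Omits W a → Omits W b →
      W.card + 2 ≤ r + n := fun a b ha hb hab hWa hWb =>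
    card_add_two_le_of_notMem (a := ⟨a, ha⟩) (b := ⟨b, hb⟩) (fun h => hab (Fin.ext_iff.1 h))
      (fun h => hWa _ h rfl) fun h => hWb _ h rfl
  obtain ⟨-, -, h⟩ | ⟨v, hv, h1, h2, -, h⟩ | ⟨-, -, h⟩ := ACH_splits_cases hn hW
  · refine key (r + n - 1) (r + n - 2) (by omega) (by omega) (by omega) (fun u hu => ?_)
      fun u hu => ?_ <;>
    · have := h u hu
      omega
  · by_cases hv5 : (v : ℕ) + 5 < r + n
    · refine key (r + n - 1) (v + 1) (by omega) (by omega) (by omega) (fun u hu => ?_)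
        fun u hu => ?_ <;>
      · have := h u hu
        omega
    · refine key (r + n - 1) (r + n - 3) (by omega) (by omega) (by omega) (fun u hu => ?_)
        fun u hu => ?_ <;>
      · have := h u hu
        omega
  · refine key (r + n - 2) (r + n - 3) (by omega) (by omega) (by omega) (fun u hu => ?_)
      fun u hu => ?_ <;>
    · have := h u hu
      omega

/-- Take `e`, `a` and any `k` of the `r + n - 4` vertices below `e`: without `d` and `b`, the vertex
`e` is isolated. -/
theorem ACH_exists_splits (hn : 6 ≤ n) {k : ℕ} (hk : k ≤ n + r - 4) :
    ∃ W : Finset (Fin (r + n)), W.card = k + 2 ∧ (ACH n r).Splits W := by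
  let e : Fin (r + n) := ⟨r + n - 4, by omega⟩
  let a : Fin (r + n) := ⟨r + n - 1, by omega⟩
  obtain ⟨X, hX, hXk⟩ := Finset.exists_subset_card_eq (s := Finset.Iio e) (n := k) (by
    rw [Fin.card_Iio]
    change k ≤ r + n - 4
    omega)
  have hXe : ∀ u ∈ X, u < e := fun u hu => Finset.mem_Iio.1 (hX hu)
  have hea : e < a := Fin.lt_def.2 (by change r + n - 4 < r + n - 1; omega)
  have heX : e ∉ X := fun h => lt_irrefl _ (hXe e h)
  have haX : a ∉ insert e X := by
    rw [Finset.mem_insert, not_or]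
    exact ⟨hea.ne', fun h => lt_asymm hea (hXe a h)⟩
  refine ⟨insert a (insert e X), ?_, ?_⟩
  · rw [Finset.card_insert_of_notMem haX, Finset.card_insert_of_notMem heX, hXk]
  · refine ACH_splits_of_end hn (v := e) (u := a) (by simp) (by simp)
      (by change r + n - 4 + 4 = _; omega) (by change r + n - 1 + 1 = _; omega) fun u hu => ?_
    rw [Finset.mem_insert, Finset.mem_insert] at hu
    rcases hu with rfl | rfl | hu
    · change r + n - 1 + 3 ≠ _ ∧ r + n - 1 + 2 ≠ _
      omega
    · change r + n - 4 + 3 ≠ _ ∧ r + n - 4 + 2 ≠ _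
      omega
    · have : (u : ℕ) < r + n - 4 := Fin.lt_def.1 (hXe u hu)
      omega

theorem ACH_exists_isolated_pair (hn : 6 ≤ n) {k : ℕ} (hk : n - 4 ≤ k) (hk' : k ≤ n + r - 4) :
    ∃ W₁ W₂ : Finset (Fin (r + n)), (W₁.card = k + 2 ∧ (ACH n r).Splits W₁) ∧
      (W₂.card = k + 2 ∧ (ACH n r).Splits W₂) ∧ 2 ≤ (W₁ \ W₂).card ∧
      ∀ W, W.card = k + 2 → (ACH n r).Splits W → W ⊆ W₁ ∪ W₂ → W = W₁ ∨ W = W₂ := by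
  classical
  -- `Finset.Ici c` consists of the last `k + 4` vertices; `n - 4 ≤ k` guarantees that it contains
  -- all of `H_n`, in particular `p` and `q`.
  let c : Fin (r + n) := ⟨r + n - (k + 4), by omega⟩
  have hcval : (c : ℕ) = r + n - (k + 4) := rfl
  obtain ⟨p, hp⟩ : ∃ p : Fin (r + n), (p : ℕ) = r := ⟨⟨r, by omega⟩, rfl⟩
  obtain ⟨q, hq⟩ : ∃ q : Fin (r + n), (q : ℕ) = r + 1 := ⟨⟨r + 1, by omega⟩, rfl⟩
  obtain ⟨e, he⟩ : ∃ e : Fin (r + n), (e : ℕ) + 4 = r + n := ⟨⟨r + n - 4, by omega⟩, by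
    change r + n - 4 + 4 = _; omega⟩
  obtain ⟨d, hd⟩ : ∃ d : Fin (r + n), (d : ℕ) + 3 = r + n := ⟨⟨r + n - 3, by omega⟩, by
    change r + n - 3 + 3 = _; omega⟩
  obtain ⟨b, hb⟩ : ∃ b : Fin (r + n), (b : ℕ) + 2 = r + n := ⟨⟨r + n - 2, by omega⟩, by
    change r + n - 2 + 2 = _; omega⟩
  obtain ⟨a, ha⟩ : ∃ a : Fin (r + n), (a : ℕ) + 1 = r + n := ⟨⟨r + n - 1, by omega⟩, by
    change r + n - 1 + 1 = _; omega⟩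
  have hV : ∀ u, u ∈ Finset.Ici c ↔ r + n ≤ (u : ℕ) + k + 4 := fun u => by
    rw [Finset.mem_Ici, Fin.le_def, hcval]
    omega
  have hVcard : (Finset.Ici c).card = k + 4 := by
    rw [Fin.card_Ici, hcval]
    omega
  have hcard : ∀ u v, u ≠ v → u ∈ Finset.Ici c → v ∈ Finset.Ici c →
      (Finset.Ici c \ {u, v}).card = k + 2 := by
    intro u v huv hu hv
    rw [Finset.card_sdiff_of_subset, hVcard, Finset.card_pair huv]
    · rfl
    · rw [Finset.insert_subset_iff, Finset.singleton_subset_iff]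
      exact ⟨hu, hv⟩
  have hmem : ∀ u v w, w ∈ Finset.Ici c \ {u, v} ↔
      r + n ≤ (w : ℕ) + k + 4 ∧ (w : ℕ) ≠ u ∧ (w : ℕ) ≠ v := by
    intro u v w
    rw [Finset.mem_sdiff, hV, Finset.mem_insert, Finset.mem_singleton, not_or, Fin.ext_iff,
      Fin.ext_iff]
  have hne : ∀ {u v : Fin (r + n)}, (u : ℕ) ≠ v → u ≠ v := fun h h' => h (congrArg _ h')
  have hdb : d ≠ b := hne (by omega)
  have hqa : q ≠ a := hne (by omega)
  have h1 := hcard d b hdb ((hV d).2 (by omega)) ((hV b).2 (by omega))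
  have h2 := hcard q a hqa ((hV q).2 (by omega)) ((hV a).2 (by omega))
  refine ⟨Finset.Ici c \ {d, b}, Finset.Ici c \ {q, a}, ⟨h1, ?_⟩, ⟨h2, ?_⟩, ?_, ?_⟩
  · refine ACH_splits_of_end hn (v := e) (u := a) ((hmem _ _ _).2 (by omega))
      ((hmem _ _ _).2 (by omega)) he ha fun u hu => ?_
    have := (hmem _ _ _).1 hu
    omega
  · refine ACH_splits_of_path_gap hn (v := p) (u := b) ((hmem _ _ _).2 (by omega))
      ((hmem _ _ _).2 (by omega)) (Fin.lt_def.2 (by omega)) hp.ge (by omega) fun u hu => ?_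
    have := (hmem _ _ _).1 hu
    omega
  · rw [← Finset.card_pair hqa]
    refine Finset.card_le_card fun u hu => ?_
    rw [Finset.mem_sdiff, hmem, hmem]
    rw [Finset.mem_insert, Finset.mem_singleton] at hu
    rcases hu with rfl | rfl <;> omega
  · intro W hW hsplit hsub
    have hWV : ∀ u ∈ W, r + n ≤ (u : ℕ) + k + 4 := fun u hu => by
      rcases Finset.mem_union.1 (hsub hu) with h | h
      · exact ((hmem _ _ _).1 h).1
      · exact ((hmem _ _ _).1 h).1
    have heq : ∀ u v, (Finset.Ici c \ {u, v}).card = k + 2 →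
        (∀ w ∈ W, (w : ℕ) ≠ u ∧ (w : ℕ) ≠ v) → W = Finset.Ici c \ {u, v} := by
      intro u v huv h
      exact Finset.eq_of_subset_of_card_le
        (fun w hw => (hmem u v w).2 ⟨hWV w hw, h w hw⟩) (by omega)
    obtain ⟨-, -, h⟩ | ⟨v, hv, hv1, hv2, -, h⟩ | ⟨-, -, h⟩ := ACH_splits_cases hn hsplit
    · refine Or.inl (heq d b h1 fun w hw => ?_)
      have := h w hw
      omega
    · refine Or.inr (heq q a h2 fun w hw => ?_)
      -- A witness on the path other than `p` would force three omissions, `a`, `b` and its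
      -- successor, while `W` misses only two elements of `Finset.Ici c`.
      have hvr : (v : ℕ) = r := by
        by_contra hvr
        have h3 := hcard b a (hne (by omega)) ((hV b).2 (by omega)) ((hV a).2 (by omega))
        have h4 := heq b a h3 fun w hw => by
          have := h w hw
          omega
        by_cases hv5 : (v : ℕ) + 5 < r + n
        · have h5 : (⟨v + 1, by omega⟩ : Fin (r + n)) ∈ W := by
            rw [h4]
            refine (hmem _ _ _).2 ?_
            change r + n ≤ (v : ℕ) + 1 + k + 4 ∧ (v : ℕ) + 1 ≠ b ∧ (v : ℕ) + 1 ≠ a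
            omega
          exact (h _ h5).2.1 hv5 rfl
        · have h5 : d ∈ W := by
            rw [h4]
            exact (hmem _ _ _).2 (by omega)
          exact (h _ h5).2.2.1 (by omega) hd
      have := h w hw
      omega
    · refine Or.inl (heq d b h1 fun w hw => ?_)
      have := h w hw
      omega

end ACH

theorem theorem4p2 (K : Type*) [Field K] (n r : ℕ) (hn : 6 ≤ n) :
    (∀ k : ℕ, 2 ≤ k → k < n - 4 →
      HS k (edgeIdeal K (ACH n r)ᶜ) ≠ ⊥ ∧ HasLinearQuotients (HS k (edgeIdeal K (ACH n r)ᶜ))) ∧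
    (∀ k : ℕ, n - 4 ≤ k → k ≤ n + r - 4 →
      HS k (edgeIdeal K (ACH n r)ᶜ) ≠ ⊥ ∧ ¬ HasLinearQuotients (HS k (edgeIdeal K (ACH n r)ᶜ))) ∧
    (∀ k : ℕ, n + r - 4 < k → HS k (edgeIdeal K (ACH n r)ᶜ) = ⊥) := by
  simp only [HS_edgeIdeal_compl (K := K) (ACH_adj_of_adj_of_adj (r := r) hn)]
  refine ⟨fun k _ hk => ⟨?_, ?_⟩, fun k hk hk' => ⟨?_, ?_⟩, fun k hk => ?_⟩
  · exact span_sqfree_ne_bot (ACH_exists_splits hn (by omega))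
  · refine hasLinearQuotients_of_lex_exchange (s := k + 2) (fun W hW => hW.1) ?_
    rintro W ⟨hWc, hW⟩ W' ⟨hWc', hW'⟩ x hx' hx hagree
    obtain ⟨x', hx'W', hx'W, w, hw, hlt, hsplit⟩ :=
      ACH_exchange hn hW hW' (hWc.trans hWc'.symm) (by omega) hx' hx hagree
    refine ⟨x', hx'W', hx'W, w, hw, hlt, ?_, hsplit⟩
    rw [Finset.card_insert_of_notMem (fun h => hx'W (Finset.mem_of_mem_erase h)),
      Finset.card_erase_add_one hw, hWc]
  · exact span_sqfree_ne_bot (ACH_exists_splits hn hk')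
  · obtain ⟨W₁, W₂, h1, h2, hcard, h⟩ := ACH_exists_isolated_pair hn hk hk'
    exact not_hasLinearQuotients_of_pair (s := k + 2) (fun W hW => hW.1) h1 h2 hcard
      fun W hW hsub => h W hW.1 hW.2 hsub
  · have hempty : {W : Finset (Fin (r + n)) | W.card = k + 2 ∧ (ACH n r).Splits W} = ∅ := by
      rw [Set.eq_empty_iff_forall_notMem]
      rintro W ⟨hW, hsplit⟩
      have := ACH_card_add_two_le hn hsplit
      omega
    rw [hempty]
    simp
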